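/- Fix $d$ and a norm $N$ on $\mathbb R^d$. Let $L>0$, $0\le B<1$, and let $\pi:[0,1]^d\to(0,1]$ satisfy $|\pi(x)-\pi(y)|\le L\,N(x-y)$ for all $x,y\in[0,1]^d$. Let $\mathcal S=\{(x_i,s_i)\}_{i=1,\dots,t}$ consist of $t$ independent experiments, where $x_i$ is uniform on $[0,1]^d$ and, given $x_i$, $s_i\sim\mathrm{Bernoulli}((1-B)\pi(x_i)+B)$. Inference algorithm. Given a query point $x\in[0,1]^d$, a prior $\mathrm{Beta}(\alpha,\beta)$ with $\alpha,\beta>0$, and a constant $\kappa>0$: set the kernel width $\Delta=\kappa L^{-2/(d+2)}((1-B)t)^{-1/(d+2)}$; let $n$ be the number of experiments with $\|x-x_i\|_\infty\le\Delta$ and $s$ the number of successes ($s_i=1$) among these $n$ experiments; output the posterior $$\tilde\pi(x|\mathcal S)\sim\sum_{i=0}^{s}C_i\,\mathrm{Beta}(\alpha+i,\beta+n-i),\qquad C_i\propto\binom{s}{i}\Gamma(\alpha+i)\,\Gamma(\beta+n-i)\,B^{s-i},\qquad \sum_{i=0}^{s}C_i=1,$$ that is, the numbers $s$ and $C_i,\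 \alpha+i,\ \beta+n-i$ for $0\le i\le s$. (1) For the uniform prior $\alpha=\beta=1$ and every $\kappa>0$ there is a constant $C$ depending only on $d$, $N$ and $\kappa$ such that, for all $L$, $B$, $\pi$ as above and all $t$ with $L^2(1-B)t\ge1$, $$\sup_{x\in[0,1]^d}\mathbb E_{\mathcal S}\,\mathbb E\big[(\tilde\pi(x|\mathcal S)-\pi(x))^2\big]\le C\,L^{\frac{2d}{d+2}}\big((1-B)t\big)^{-\frac{2}{d+2}}.$$ In particular, for fixed $L$ and $B$ the left-hand side is $\mathcal O\big(L^{2d/(d+2)}((1-B)t)^{-2/(d+2)}\big)$ as $t\to\infty$. (2) There is a constant $K$ depending only on $d$ such that, for every $t\ge1$, all data $(x_i,s_i)_{i\le t}$, every query point $x$ and all $\kappa,L>0$, $0\le B<1$, $\alpha,\beta>0$, the algorithm, run as a program on a real random access machine (unit cost for memory accesses, arithmetic operations, root extraction, comparisons, assignments and loop steps), computes exactly this posterior in at most $K\,t$ steps. -/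

import Mathlib

open MeasureTheory ProbabilityTheory

namespace SmoothBeta

/-! ## The statistical model -/

/-- The feature space `[0,1]^d`. Its `volume` is the uniform probability measure. -/
abbrev Cube (d : ℕ) : Type := Fin d → unitInterval

/-- The vector in `ℝ^d` underlying a point of the cube. -/
def Cube.vec {d : ℕ} (x : Cube d) : Fin d → ℝ := fun j => (x j : ℝ)

/-- The outcomes of `t` experiments: the test points and, for each of them, whether the
Bernoulli test succeeded. -/
abbrev Data (d t : ℕ) : Type := Fin t → Cube d × Bool

/-- The success probability `(1 - B) π(x) + B` of a test performed at `x` in the context `B`. -/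
def successProb {d : ℕ} (π : Cube d → ℝ) (B : ℝ) (x : Cube d) : ℝ := (1 - B) * π x + B

/-- The joint law of one experiment `(x, s)`: the point `x` is uniform on the cube and, given `x`,
the outcome `s` is Bernoulli with parameter `(1 - B) π(x) + B`. It is written through its density
with respect to the product of the uniform law and the counting measure on `{true, false}`. -/
noncomputable def experimentLaw {d : ℕ} (π : Cube d → ℝ) (B : ℝ) : Measure (Cube d × Bool) :=
  ((volume : Measure (Cube d)).prod Measure.count).withDensity fun z =>
    ENNReal.ofReal (if z.2 = true then successProb π B z.1 else 1 - successProb π B z.1)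

/-- The law of `t` independent experiments. -/
noncomputable def dataLaw {d : ℕ} (π : Cube d → ℝ) (B : ℝ) (t : ℕ) : Measure (Data d t) :=
  Measure.pi fun _ => experimentLaw π B

/-! ## The posterior -/

open Classical in
/-- The indices of the experiments in the box of half-width `Δ` around `x`. -/
noncomputable def neighbors {d t : ℕ} (Δ : ℝ) (S : Data d t) (x : Cube d) : Finset (Fin t) :=
  Finset.univ.filter fun i => ∀ j, |x.vec j - (S i).1.vec j| ≤ Δ

/-- The number of experiments in the box around `x`. -/
noncomputable def numNear {d t : ℕ} (Δ : ℝ) (S : Data d t) (x : Cube d) : ℕ :=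
  (neighbors Δ S x).card

/-- The number of successes among the experiments in the box around `x`. -/
noncomputable def numSucc {d t : ℕ} (Δ : ℝ) (S : Data d t) (x : Cube d) : ℕ :=
  ((neighbors Δ S x).filter fun i => (S i).2 = true).card

/-- The unnormalised weight `(s choose i) (α-1+i)! (β+n-1-i)! B^(s-i)` of the component
`Beta(α+i, β+n-i)`, for `s` successes in `n` tests. -/
noncomputable def mixWeight (α β B : ℝ) (n s i : ℕ) : ℝ :=
  (s.choose i : ℝ) * Real.Gamma (α + i) * Real.Gamma (β + ((n : ℝ) - i)) * B ^ (s - i)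

/-- The normalised weights: `∑ i ∈ {0, …, s}, mixCoef α β B n s i = 1`. -/
noncomputable def mixCoef (α β B : ℝ) (n s i : ℕ) : ℝ :=
  mixWeight α β B n s i / ∑ j ∈ Finset.range (s + 1), mixWeight α β B n s j

/-- The mixture `∑ i ∈ {0, …, s}, C_i Beta(α+i, β+n-i)`. -/
noncomputable def betaMixture (α β B : ℝ) (n s : ℕ) : Measure ℝ :=
  ∑ i ∈ Finset.range (s + 1),
    ENNReal.ofReal (mixCoef α β B n s i) • betaMeasure (α + i) (β + ((n : ℝ) - i))

/-- The posterior of the success probability at `x`, from the prior `Beta(α, β)`: all the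
experiments in the box around `x` are used as if they had been performed at `x`. -/
noncomputable def posterior {d t : ℕ} (α β B Δ : ℝ) (S : Data d t) (x : Cube d) : Measure ℝ :=
  betaMixture α β B (numNear Δ S x) (numSucc Δ S x)

/-- The kernel width `Δ = κ L^(-2/(d+2)) ((1-B) t)^(-1/(d+2))`. -/
noncomputable def kernelWidth (d : ℕ) (κ L B : ℝ) (t : ℕ) : ℝ :=
  κ * L ^ (-(2 : ℝ) / ((d : ℝ) + 2)) * ((1 - B) * t) ^ (-(1 : ℝ) / ((d : ℝ) + 2))

/-- The quantity `𝔼_S 𝔼 (π̃(x | S) - π(x))²`, for the uniform prior `Beta(1, 1)`. -/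
noncomputable def meanSquareError {d : ℕ} (π : Cube d → ℝ) (B Δ : ℝ) (t : ℕ) (x : Cube d) :
    ENNReal :=
  ∫⁻ S, (∫⁻ θ, ENNReal.ofReal ((θ - π x) ^ 2) ∂(posterior 1 1 B Δ S x)) ∂(dataLaw π B t)

/-- The worst case over the query point, `sup_x 𝔼_S 𝔼 (π̃(x | S) - π(x))²`. -/
noncomputable def supMeanSquareError {d : ℕ} (π : Cube d → ℝ) (B Δ : ℝ) (t : ℕ) : ENNReal :=
  ⨆ x : Cube d, meanSquareError π B Δ t x

/-! ## A real random access machine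

A structured language over a memory with integer registers (named by `V`) and arrays of real
numbers (named by `A`). Every memory access, literal, arithmetic operation, root extraction,
comparison, assignment and loop step costs one unit of time. -/

/-- The state of the memory. -/
structure Store (V A : Type) where
  /-- integer registers -/
  nat : V → ℕ
  /-- arrays of real numbers -/
  arr : A → ℕ → ℝ

/-- Integer expressions. -/
inductive NExp (V : Type) : Type
  | lit (k : ℕ)
  | var (v : V)
  | add (e f : NExp V)
  | sub (e f : NExp V)
  | mul (e f : NExp V)

/-- Real expressions; `get a i` reads the cell `i` of the array `a`. -/
inductive RExp (V A : Type) : Type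
  | lit (k : ℕ)
  | ofNat (e : NExp V)
  | get (a : A) (i : NExp V)
  | add (e f : RExp V A)
  | sub (e f : RExp V A)
  | mul (e f : RExp V A)
  | div (e f : RExp V A)
  | root (k : NExp V) (e : RExp V A)

/-- Commands; `loop v n c` runs `c` with `v = 0, …, n - 1`, where `n` is evaluated on entry. -/
inductive Cmd (V A : Type) : Type
  | skip
  | setN (v : V) (e : NExp V)
  | setR (a : A) (i : NExp V) (e : RExp V A)
  | seq (c c' : Cmd V A)
  | ifLE (e f : RExp V A) (c c' : Cmd V A)
  | loop (v : V) (n : NExp V) (c : Cmd V A)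

section Semantics

variable {V A : Type}

def NExp.eval (σ : Store V A) : NExp V → ℕ
  | .lit k => k
  | .var v => σ.nat v
  | .add e f => e.eval σ + f.eval σ
  | .sub e f => e.eval σ - f.eval σ
  | .mul e f => e.eval σ * f.eval σ

def NExp.cost : NExp V → ℕ
  | .lit _ => 1
  | .var _ => 1
  | .add e f => e.cost + f.cost + 1
  | .sub e f => e.cost + f.cost + 1
  | .mul e f => e.cost + f.cost + 1

noncomputable def RExp.eval (σ : Store V A) : RExp V A → ℝ
  | .lit k => (k : ℝ)
  | .ofNat e => (e.eval σ : ℝ)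
  | .get a i => σ.arr a (i.eval σ)
  | .add e f => e.eval σ + f.eval σ
  | .sub e f => e.eval σ - f.eval σ
  | .mul e f => e.eval σ * f.eval σ
  | .div e f => e.eval σ / f.eval σ
  | .root k e => (e.eval σ) ^ (1 / (k.eval σ : ℝ))

def RExp.cost : RExp V A → ℕ
  | .lit _ => 1
  | .ofNat e => e.cost + 1
  | .get _ i => i.cost + 1
  | .add e f => e.cost + f.cost + 1
  | .sub e f => e.cost + f.cost + 1
  | .mul e f => e.cost + f.cost + 1
  | .div e f => e.cost + f.cost + 1
  | .root k e => k.cost + e.cost + 1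

variable [DecidableEq V] [DecidableEq A]

def Store.setNat (σ : Store V A) (v : V) (k : ℕ) : Store V A :=
  { σ with nat := Function.update σ.nat v k }

def Store.setArr (σ : Store V A) (a : A) (i : ℕ) (r : ℝ) : Store V A :=
  { σ with arr := Function.update σ.arr a (Function.update (σ.arr a) i r) }

/-- `m` rounds of a timed step, numbered `0, …, m - 1`; a round costs one unit more than its
step. -/
def runLoop (step : ℕ → Store V A → Store V A × ℕ) : ℕ → Store V A → Store V A × ℕ
  | 0, σ => (σ, 0)
  | m + 1, σ =>
    let r := runLoop step m σ
    let r' := step m r.1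
    (r'.1, r.2 + r'.2 + 1)

open Classical in
/-- The effect of a command on the memory, and the time that it takes. -/
noncomputable def Cmd.run : Cmd V A → Store V A → Store V A × ℕ
  | .skip, σ => (σ, 0)
  | .setN v e, σ => (σ.setNat v (e.eval σ), e.cost + 1)
  | .setR a i e, σ => (σ.setArr a (i.eval σ) (e.eval σ), i.cost + e.cost + 1)
  | .seq c c', σ =>
    let r := c.run σ
    let r' := c'.run r.1
    (r'.1, r.2 + r'.2)
  | .ifLE e f c c', σ =>
    let r := if e.eval σ ≤ f.eval σ then c.run σ else c'.run σ
    (r.1, e.cost + f.cost + 1 + r.2)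
  | .loop v n c, σ =>
    let r := runLoop (fun k τ => c.run (τ.setNat v k)) (n.eval σ) σ
    (r.1, n.cost + 1 + r.2)

end Semantics

/-! ## The inference algorithm as a program -/

/-- Integer registers: the number `t` of tests, the dimension `d`, the number of neighboring
tests, the number of successes among them, and two indices. -/
inductive Reg : Type
  | tests
  | dim
  | near
  | succs
  | i
  | j
  deriving DecidableEq

/-- Real arrays. Scalars are kept in the cell `0`. -/
inductive Arr : Type
  | point
  | outcome
  | query
  | context
  | priorA
  | priorB
  | lipschitz
  | kappa
  | width
  | flag
  | weight
  | total
  | coef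
  | shapeA
  | shapeB
  deriving DecidableEq

abbrev Memory : Type := Store Reg Arr

/-- The scalar kept in the cell `0` of `a`. -/
def scalar (a : Arr) : RExp Reg Arr := .get a (.lit 0)

/-- The coordinate `j` of the test point `i`. -/
def pointCoord : RExp Reg Arr := .get .point (.add (.mul (.var .i) (.var .dim)) (.var .j))

/-- `width := κ / (L * L * (1 - B) * t)^(1/(d+2))`. -/
def setWidth : Cmd Reg Arr :=
  .setR .width (.lit 0)
    (.div (scalar .kappa)
      (.root (.add (.var .dim) (.lit 2))
        (.mul (.mul (.mul (scalar .lipschitz) (scalar .lipschitz))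
          (.sub (.lit 1) (scalar .context))) (.ofNat (.var .tests)))))

/-- `flag := 1` if the test point `i` lies in the box around the query point, else `0`. -/
def testNear : Cmd Reg Arr :=
  .seq (.setR .flag (.lit 0) (.lit 1))
    (.loop .j (.var .dim)
      (.seq
        (.ifLE (.sub (.get .query (.var .j)) pointCoord) (scalar .width)
          .skip (.setR .flag (.lit 0) (.lit 0)))
        (.ifLE (.sub pointCoord (.get .query (.var .j))) (scalar .width)
          .skip (.setR .flag (.lit 0) (.lit 0)))))

/-- Count the neighboring tests and the successes among them. -/
def countNear : Cmd Reg Arr :=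
  .seq (.setN .near (.lit 0)) <|
  .seq (.setN .succs (.lit 0)) <|
  .loop .i (.var .tests) <|
  .seq testNear <|
  .ifLE (.lit 1) (scalar .flag)
    (.seq (.setN .near (.add (.var .near) (.lit 1)))
      (.ifLE (.lit 1) (.get .outcome (.var .i))
        (.setN .succs (.add (.var .succs) (.lit 1)))
        .skip))
    .skip

/-- The weights up to a common factor, through the relation
`C_(i+1) = (s-i)(α+i) / (B(i+1)(β+n-1-i)) C_i` solved for `C_i` and run downwards from `C_s := 1`,
so that nothing is divided by `B`, which may be `0`. -/
def setWeights : Cmd Reg Arr :=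
  .seq (.setR .weight (.var .succs) (.lit 1)) <|
  .loop .j (.var .succs) <|
  .seq (.setN .i (.sub (.sub (.var .succs) (.lit 1)) (.var .j))) <|
  .setR .weight (.var .i)
    (.div
      (.mul (.get .weight (.add (.var .i) (.lit 1)))
        (.mul (.mul (scalar .context) (.ofNat (.add (.var .i) (.lit 1))))
          (.add (scalar .priorB) (.ofNat (.sub (.sub (.var .near) (.lit 1)) (.var .i))))))
      (.mul (.ofNat (.sub (.var .succs) (.var .i)))
        (.add (scalar .priorA) (.ofNat (.var .i)))))

/-- Normalise the weights and write out the parameters of the mixture. -/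
def writePosterior : Cmd Reg Arr :=
  .seq (.setR .total (.lit 0) (.lit 0)) <|
  .seq
    (.loop .i (.add (.var .succs) (.lit 1))
      (.setR .total (.lit 0) (.add (scalar .total) (.get .weight (.var .i))))) <|
  .loop .i (.add (.var .succs) (.lit 1)) <|
  .seq (.setR .coef (.var .i) (.div (.get .weight (.var .i)) (scalar .total))) <|
  .seq (.setR .shapeA (.var .i) (.add (scalar .priorA) (.ofNat (.var .i)))) <|
  .setR .shapeB (.var .i)
    (.add (scalar .priorB) (.ofNat (.sub (.var .near) (.var .i))))

/-- The inference algorithm, at one query point: set the kernel width, find the neighboring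
experiments, compute the posterior from them. -/
def inference : Cmd Reg Arr :=
  .seq setWidth (.seq countNear (.seq setWeights writePosterior))

/-- The memory holds the input of the algorithm; the cells not mentioned are arbitrary. -/
structure HoldsInput {d t : ℕ} (σ : Memory) (κ L B α β : ℝ) (S : Data d t) (x : Cube d) :
    Prop where
  tests : σ.nat .tests = t
  dim : σ.nat .dim = d
  point : ∀ (i : Fin t) (j : Fin d), σ.arr .point (i * d + j) = (S i).1.vec j
  outcome : ∀ i : Fin t, σ.arr .outcome i = if (S i).2 = true then 1 else 0
  query : ∀ j : Fin d, σ.arr .query j = x.vec j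
  context : σ.arr .context 0 = B
  priorA : σ.arr .priorA 0 = α
  priorB : σ.arr .priorB 0 = β
  lipschitz : σ.arr .lipschitz 0 = L
  kappa : σ.arr .kappa 0 = κ

/-- The memory describes the mixture `betaMixture α β B n s`: it holds `s`, and for every
`i ∈ {0, …, s}` the weight `C_i` and the two parameters of the component `i`. -/
structure HoldsMixture (σ : Memory) (α β B : ℝ) (n s : ℕ) : Prop where
  succs : σ.nat .succs = s
  coef : ∀ i ≤ s, σ.arr .coef i = mixCoef α β B n s i
  shapeA : ∀ i ≤ s, σ.arr .shapeA i = α + i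
  shapeB : ∀ i ≤ s, σ.arr .shapeB i = β + ((n : ℝ) - i)

end SmoothBeta

/-!
By Bayes' rule the mixture is the prior reweighted by the likelihood of `s` successes and `r`
failures, `((1 - B) θ + B) ^ s (1 - θ) ^ r`. The derivative of the likelihood with one more success
and one more failure is the likelihood times an affine function of `θ`, so for the uniform prior an
integration by parts bounds the second moment of the posterior around `p = π x` by
`(D / ((1 - B) (n + 2))) ^ 2 + 4 / ((1 - B) (n + 2))`, where `n = s + r` and
`D = r - (1 - B) (1 - p) n` is the excess of failures. Smoothness makes `D` a bias of order
`(1 - B) n L Δ` plus a sum of centered independent noises, which stay orthogonal when reweighted by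
a function of `n`, so that their contribution is an inverse moment of `n + 1`, at most the inverse
of `t` times the volume of the box around `x`. The kernel width balances the squared bias and this
variance.

The program needs no Gamma function, since the ratio of consecutive weights of the mixture is
rational in the parameters, and it computes the weights downwards from index `s`: upwards the
recursion would divide by zero for `B = 0`.
-/

namespace SmoothBeta

/-! ### The posterior -/

section Beta

variable {α β B : ℝ}

lemma betaPDFReal_nonneg (hα : 0 < α) (hβ : 0 < β) (θ : ℝ) : 0 ≤ betaPDFReal α β θ := by
  by_cases hθ : 0 < θ ∧ θ < 1
  · exact (betaPDFReal_pos hθ.1 hθ.2 hα hβ).le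
  · rw [betaPDFReal, if_neg hθ]

lemma measurable_betaPDF (α β : ℝ) : Measurable (betaPDF α β) :=
  (measurable_betaPDFReal α β).ennreal_ofReal

lemma ae_mem_Ioo_betaMeasure (α β : ℝ) : ∀ᵐ θ ∂betaMeasure α β, θ ∈ Set.Ioo (0 : ℝ) 1 := by
  rw [betaMeasure, ae_withDensity_iff (measurable_betaPDF α β)]
  refine .of_forall fun θ hθ => ?_
  by_contra h
  exact hθ (by rw [betaPDF_eq, if_neg (by simpa using h), ENNReal.ofReal_zero])

lemma betaMeasure_one_one : betaMeasure 1 1 = volume.restrict (Set.Ioo 0 1) := by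
  rw [← withDensity_indicator_one measurableSet_Ioo, betaMeasure]
  congr 1 with θ
  by_cases hθ : 0 < θ ∧ θ < 1 <;> simp [betaPDF_eq, beta, one_add_one_eq_two, hθ]

lemma betaPDFReal_add_natCast (hα : 0 < α) (hβ : 0 < β) (i k : ℕ) (θ : ℝ) :
    betaPDFReal (α + i) (β + k) θ =
      betaPDFReal α β θ * (beta α β / beta (α + i) (β + k) * (θ ^ i * (1 - θ) ^ k)) := by
  have hb : beta α β ≠ 0 := (beta_pos hα hβ).ne'
  by_cases hθ : 0 < θ ∧ θ < 1
  · rw [betaPDFReal, betaPDFReal, if_pos hθ, if_pos hθ, add_sub_right_comm, add_sub_right_comm,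
      Real.rpow_add_natCast hθ.1.ne', Real.rpow_add_natCast (sub_pos.2 hθ.2).ne']
    field_simp
  · rw [betaPDFReal, betaPDFReal, if_neg hθ, if_neg hθ, zero_mul]

lemma betaMeasure_add_natCast (hα : 0 < α) (hβ : 0 < β) (i k : ℕ) :
    betaMeasure (α + i) (β + k) = (betaMeasure α β).withDensity fun θ =>
      ENNReal.ofReal (beta α β / beta (α + i) (β + k) * (θ ^ i * (1 - θ) ^ k)) := by
  rw [betaMeasure, betaMeasure, ← withDensity_mul _ (measurable_betaPDF α β) (by fun_prop)]
  congr 1 with θ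
  rw [betaPDF, betaPDFReal_add_natCast hα hβ, ENNReal.ofReal_mul (betaPDFReal_nonneg hα hβ θ),
    Pi.mul_apply, betaPDF]

lemma integrable_betaMeasure_of_continuous (hα : 0 < α) (hβ : 0 < β) {f : ℝ → ℝ}
    (hf : Continuous f) : Integrable f (betaMeasure α β) := by
  have := isProbabilityMeasureBeta hα hβ
  obtain ⟨C, hC⟩ := isCompact_Icc.exists_bound_of_continuousOn
    (hf.continuousOn (s := Set.Icc (0 : ℝ) 1))
  refine .of_bound hf.aestronglyMeasurable C ?_
  filter_upwards [ae_mem_Ioo_betaMeasure α β] with θ hθ using hC θ (Set.Ioo_subset_Icc_self hθ)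

lemma integral_pow_mul_one_sub_pow_betaMeasure (hα : 0 < α) (hβ : 0 < β) (i k : ℕ) :
    ∫ θ, θ ^ i * (1 - θ) ^ k ∂betaMeasure α β = beta (α + i) (β + k) / beta α β := by
  have hb : 0 < beta α β := beta_pos hα hβ
  have hbik : 0 < beta (α + i) (β + k) := beta_pos (by positivity) (by positivity)
  have hprob := isProbabilityMeasureBeta (α := α + i) (β := β + k) (by positivity) (by positivity)
  have htotal : ∫⁻ θ, ENNReal.ofReal (beta α β / beta (α + i) (β + k) * (θ ^ i * (1 - θ) ^ k))
      ∂betaMeasure α β = 1 := by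
    rw [← setLIntegral_univ, ← withDensity_apply _ .univ, ← betaMeasure_add_natCast hα hβ,
      measure_univ]
  rw [← ofReal_integral_eq_lintegral_ofReal
    (integrable_betaMeasure_of_continuous hα hβ (by fun_prop)), integral_const_mul,
    ENNReal.ofReal_eq_one] at htotal
  · field_simp at htotal ⊢
    linarith
  · filter_upwards [ae_mem_Ioo_betaMeasure α β] with θ hθ
    have := hθ.1
    have := sub_pos.2 hθ.2
    simp only [Pi.zero_apply]
    positivity

/-- The likelihood of the success probability `θ` given `s` successes and `r` failures in the
context `B`. -/
noncomputable def likelihood (B : ℝ) (s r : ℕ) (θ : ℝ) : ℝ :=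
  ((1 - B) * θ + B) ^ s * (1 - θ) ^ r

@[fun_prop]
lemma continuous_likelihood (B : ℝ) (s r : ℕ) : Continuous (likelihood B s r) := by
  unfold likelihood; fun_prop

lemma likelihood_nonneg (hB : 0 ≤ B) (hB1 : B ≤ 1) (s r : ℕ) {θ : ℝ} (hθ : θ ∈ Set.Icc 0 1) :
    0 ≤ likelihood B s r θ := by
  have := mul_nonneg (sub_nonneg.2 hB1) hθ.1
  exact mul_nonneg (pow_nonneg (by linarith) _) (pow_nonneg (sub_nonneg.2 hθ.2) _)

lemma likelihood_eq_sum (B : ℝ) {n s : ℕ} (hsn : s ≤ n) (θ : ℝ) :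
    likelihood B s (n - s) θ =
      ∑ i ∈ Finset.range (s + 1), (s.choose i : ℝ) * B ^ (s - i) * (θ ^ i * (1 - θ) ^ (n - i)) := by
  have hmix : (1 - B) * θ + B = θ + B * (1 - θ) := by ring
  rw [likelihood, hmix, add_pow, Finset.sum_mul]
  refine Finset.sum_congr rfl fun i hi => ?_
  have his : i ≤ s := Finset.mem_range_succ_iff.1 hi
  rw [mul_pow, show n - i = (s - i) + (n - s) by omega, pow_add]
  ring

lemma integral_likelihood_betaMeasure (hα : 0 < α) (hβ : 0 < β) (B : ℝ) {n s : ℕ} (hsn : s ≤ n) :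
    ∫ θ, likelihood B s (n - s) θ ∂betaMeasure α β =
      ∑ i ∈ Finset.range (s + 1),
        (s.choose i : ℝ) * B ^ (s - i) * (beta (α + i) (β + (n - i : ℕ)) / beta α β) := by
  simp_rw [likelihood_eq_sum B hsn]
  rw [integral_finsetSum _
    fun i _ => integrable_betaMeasure_of_continuous hα hβ (by fun_prop)]
  simp_rw [integral_const_mul, integral_pow_mul_one_sub_pow_betaMeasure hα hβ]

lemma integral_likelihood_betaMeasure_nonneg (hα : 0 < α) (hβ : 0 < β) (hB : 0 ≤ B) {n s : ℕ}
    (hsn : s ≤ n) : 0 ≤ ∫ θ, likelihood B s (n - s) θ ∂betaMeasure α β := by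
  have hb : 0 < beta α β := beta_pos hα hβ
  rw [integral_likelihood_betaMeasure hα hβ B hsn]
  refine Finset.sum_nonneg fun i _ => ?_
  have : 0 < beta (α + i) (β + (n - i : ℕ)) := beta_pos (by positivity) (by positivity)
  positivity

lemma mixWeight_eq_mul_beta (hα : 0 < α) (hβ : 0 < β) (B : ℝ) {n i : ℕ} (hin : i ≤ n) (s : ℕ) :
    mixWeight α β B n s i = Real.Gamma (α + β + n) *
      ((s.choose i : ℝ) * B ^ (s - i) * beta (α + i) (β + (n - i : ℕ))) := by
  have hG : Real.Gamma (α + β + n) ≠ 0 := (Real.Gamma_pos_of_pos (by positivity)).ne'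
  rw [mixWeight, beta, Nat.cast_sub hin,
    show α + i + (β + ((n : ℝ) - i)) = α + β + n by ring]
  field_simp

lemma mixCoef_eq_div_integral_likelihood (hα : 0 < α) (hβ : 0 < β) (B : ℝ) {n s i : ℕ}
    (his : i ≤ s) (hsn : s ≤ n) :
    mixCoef α β B n s i =
      (s.choose i : ℝ) * B ^ (s - i) * (beta (α + i) (β + (n - i : ℕ)) / beta α β) /
        ∫ θ, likelihood B s (n - s) θ ∂betaMeasure α β := by
  have hG : Real.Gamma (α + β + n) ≠ 0 := (Real.Gamma_pos_of_pos (by positivity)).ne'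
  have hb : beta α β ≠ 0 := (beta_pos hα hβ).ne'
  have hsum : ∑ j ∈ Finset.range (s + 1), mixWeight α β B n s j =
      Real.Gamma (α + β + n) * (beta α β * ∫ θ, likelihood B s (n - s) θ ∂betaMeasure α β) := by
    rw [integral_likelihood_betaMeasure hα hβ B hsn, Finset.mul_sum, Finset.mul_sum]
    refine Finset.sum_congr rfl fun j hj => ?_
    rw [mixWeight_eq_mul_beta hα hβ B ((Finset.mem_range_succ_iff.1 hj).trans hsn)]
    field_simp
  rw [mixCoef, hsum, mixWeight_eq_mul_beta hα hβ B (his.trans hsn), mul_div_mul_left _ _ hG]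
  field_simp

lemma mixCoef_smul_betaMeasure (hα : 0 < α) (hβ : 0 < β) (hB : 0 ≤ B) {n s i : ℕ} (his : i ≤ s)
    (hsn : s ≤ n) :
    ENNReal.ofReal (mixCoef α β B n s i) • betaMeasure (α + i) (β + ((n : ℝ) - i)) =
      (betaMeasure α β).withDensity fun θ => ENNReal.ofReal
        ((s.choose i : ℝ) * B ^ (s - i) * (θ ^ i * (1 - θ) ^ (n - i)) /
          ∫ η, likelihood B s (n - s) η ∂betaMeasure α β) := by
  set I := ∫ η, likelihood B s (n - s) η ∂betaMeasure α β with hI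
  have hb : 0 < beta α β := beta_pos hα hβ
  have hbik : 0 < beta (α + i) (β + (n - i : ℕ)) := beta_pos (by positivity) (by positivity)
  have hI0 : 0 ≤ I := integral_likelihood_betaMeasure_nonneg hα hβ hB hsn
  rw [← Nat.cast_sub (his.trans hsn), betaMeasure_add_natCast hα hβ,
    ← withDensity_smul _ (by fun_prop), mixCoef_eq_div_integral_likelihood hα hβ B his hsn, ← hI]
  congr 1 with θ
  rw [Pi.smul_apply, smul_eq_mul, ← ENNReal.ofReal_mul (by positivity)]
  congr 1
  field_simp

/-- Bayes' rule: the mixture reweights the prior by the likelihood. -/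
lemma betaMixture_eq_withDensity (hα : 0 < α) (hβ : 0 < β) (hB : 0 ≤ B) {n s : ℕ} (hsn : s ≤ n) :
    betaMixture α β B n s = (betaMeasure α β).withDensity fun θ =>
      ENNReal.ofReal (likelihood B s (n - s) θ /
        ∫ η, likelihood B s (n - s) η ∂betaMeasure α β) := by
  have hI0 := integral_likelihood_betaMeasure_nonneg hα hβ hB hsn
  rw [betaMixture, Finset.sum_congr rfl fun i hi =>
    mixCoef_smul_betaMeasure hα hβ hB (Finset.mem_range_succ_iff.1 hi) hsn]
  ext U hU
  simp only [Measure.coe_finsetSum, Finset.sum_apply, withDensity_apply _ hU]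
  rw [← lintegral_finsetSum _ fun i _ => by fun_prop]
  refine lintegral_congr_ae (ae_restrict_of_ae ?_)
  filter_upwards [ae_mem_Ioo_betaMeasure α β] with θ hθ
  have := hθ.1
  have := sub_pos.2 hθ.2
  rw [likelihood_eq_sum B hsn, Finset.sum_div,
    ENNReal.ofReal_sum_of_nonneg fun i _ => by positivity]

lemma hasDerivAt_likelihood_succ (B : ℝ) (s r : ℕ) (θ : ℝ) :
    HasDerivAt (likelihood B (s + 1) (r + 1))
      (((1 - B) * (s + r + 2) * (1 - θ) - (r + 1)) * likelihood B s r θ) θ := by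
  have hsucc : HasDerivAt (fun θ : ℝ => (1 - B) * θ + B) (1 - B) θ := by
    simpa using ((hasDerivAt_id θ).const_mul (1 - B)).add_const B
  have hfail : HasDerivAt (fun θ : ℝ => 1 - θ) (-1) θ := (hasDerivAt_id θ).const_sub 1
  convert! (hsucc.pow (s + 1)).mul (hfail.pow (r + 1)) using 1
  simp only [likelihood, Nat.add_sub_cancel, Pi.pow_apply]
  push_cast
  ring

lemma likelihood_succ_succ_le (hB : 0 ≤ B) (hB1 : B ≤ 1) (s r : ℕ) {θ : ℝ}
    (hθ : θ ∈ Set.Icc 0 1) : likelihood B (s + 1) (r + 1) θ ≤ likelihood B s r θ := by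
  have hsplit : likelihood B (s + 1) (r + 1) θ =
      (((1 - B) * θ + B) * (1 - θ)) * likelihood B s r θ := by
    simp only [likelihood]; ring
  have hsucc : (1 - B) * θ + B ≤ 1 := by nlinarith [hθ.2]
  rw [hsplit]
  exact mul_le_of_le_one_left (likelihood_nonneg hB hB1 s r hθ)
    (mul_le_one₀ hsucc (sub_nonneg.2 hθ.2) (by linarith [hθ.1]))

lemma integral_sub_mul_deriv_likelihood_le (hB : 0 ≤ B) (hB1 : B ≤ 1) (s r : ℕ) {p : ℝ}
    (hp : 0 ≤ p) :
    ∫ θ in (0 : ℝ)..1,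
        (p - θ) * (((1 - B) * (s + r + 2) * (1 - θ) - (r + 1)) * likelihood B s r θ) ≤
      ∫ θ in (0 : ℝ)..1, likelihood B s r θ := by
  rw [intervalIntegral.integral_mul_deriv_eq_deriv_mul (u := fun θ => p - θ) (u' := fun _ => -1)
    (fun θ _ => (hasDerivAt_id θ).const_sub p)
    (fun θ _ => hasDerivAt_likelihood_succ B s r θ)
    (Continuous.intervalIntegrable (by fun_prop) _ _)
    (Continuous.intervalIntegrable (by fun_prop) _ _)]
  have hright : likelihood B (s + 1) (r + 1) 1 = 0 := by simp [likelihood]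
  have hleft : 0 ≤ p * likelihood B (s + 1) (r + 1) 0 :=
    mul_nonneg hp (likelihood_nonneg hB hB1 _ _ ⟨le_rfl, zero_le_one⟩)
  have hmono : ∫ θ in (0 : ℝ)..1, likelihood B (s + 1) (r + 1) θ ≤
      ∫ θ in (0 : ℝ)..1, likelihood B s r θ :=
    intervalIntegral.integral_mono_on zero_le_one
      (Continuous.intervalIntegrable (by fun_prop) _ _)
      (Continuous.intervalIntegrable (by fun_prop) _ _)
      fun θ hθ => likelihood_succ_succ_le hB hB1 s r hθ
  simp only [hright, sub_zero, mul_zero, neg_mul, one_mul, intervalIntegral.integral_neg]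
  linarith

lemma half_mul_sq_le_mul_add_sub {M u e D : ℝ} (hM : 0 < M) (hue : |u * e| ≤ 1) :
    M / 2 * u ^ 2 ≤ u * (M * u + e - D) + 1 + D ^ 2 / (2 * M) := by
  have hsq : 0 ≤ (M * u - D) ^ 2 / (2 * M) := by positivity
  have hexpand : (M * u - D) ^ 2 / (2 * M) = M / 2 * u ^ 2 - u * D + D ^ 2 / (2 * M) := by
    field_simp; ring
  linarith [neg_le_of_abs_le hue]

/-- The derivative of the likelihood with one more success and one more failure is the likelihood
times an affine function of `θ`, so integrating it by parts against `p - θ` controls the second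
moment around `p`. -/
lemma integral_sq_mul_likelihood_le (hB : 0 ≤ B) (hB1 : B < 1) (s r : ℕ) {p : ℝ}
    (hp : p ∈ Set.Icc 0 1) :
    ∫ θ in (0 : ℝ)..1, (θ - p) ^ 2 * likelihood B s r θ ≤
      (((r - (1 - B) * (1 - p) * (s + r)) / ((1 - B) * (s + r + 2))) ^ 2 +
        4 / ((1 - B) * (s + r + 2))) * ∫ θ in (0 : ℝ)..1, likelihood B s r θ := by
  set M : ℝ := (1 - B) * (s + r + 2) with hM
  set D : ℝ := r - (1 - B) * (1 - p) * (s + r) with hD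
  have hM0 : 0 < M := mul_pos (by linarith) (by positivity)
  have hpoint : ∀ θ ∈ Set.Icc (0 : ℝ) 1, M / 2 * ((θ - p) ^ 2 * likelihood B s r θ) ≤
      (p - θ) * ((M * (1 - θ) - (r + 1)) * likelihood B s r θ) +
        (1 + D ^ 2 / (2 * M)) * likelihood B s r θ := by
    intro θ hθ
    have hdrift : |(p - θ) * (2 * (1 - B) * (1 - p) - 1)| ≤ 1 := by
      rw [abs_mul]
      refine mul_le_one₀ (abs_le.2 ⟨?_, ?_⟩) (abs_nonneg _) (abs_le.2 ⟨?_, ?_⟩) <;>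
        nlinarith [hθ.1, hθ.2, hp.1, hp.2]
    have hderiv : M * (1 - θ) - (r + 1) = M * (p - θ) + (2 * (1 - B) * (1 - p) - 1) - D := by
      rw [hM, hD]; ring
    have := mul_le_mul_of_nonneg_right (half_mul_sq_le_mul_add_sub (D := D) hM0 hdrift)
      (likelihood_nonneg hB hB1.le s r hθ)
    rw [hderiv]
    linarith
  have hint := intervalIntegral.integral_mono_on (μ := volume) zero_le_one
    (Continuous.intervalIntegrable (by fun_prop) _ _)
    (Continuous.intervalIntegrable (by fun_prop) _ _) hpoint
  rw [intervalIntegral.integral_add (Continuous.intervalIntegrable (by fun_prop) _ _)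
      (Continuous.intervalIntegrable (by fun_prop) _ _),
    intervalIntegral.integral_const_mul, intervalIntegral.integral_const_mul] at hint
  have hparts := integral_sub_mul_deriv_likelihood_le hB hB1.le s r hp.1
  set J := ∫ θ in (0 : ℝ)..1, (θ - p) ^ 2 * likelihood B s r θ
  set I := ∫ θ in (0 : ℝ)..1, likelihood B s r θ
  have hscale : M / 2 * (((D / M) ^ 2 + 4 / M) * I) = (2 + D ^ 2 / (2 * M)) * I := by
    field_simp; ring
  refine le_of_mul_le_mul_left (a := M / 2) ?_ (by positivity)
  linarith

lemma integral_betaMeasure_one_one (f : ℝ → ℝ) :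
    ∫ θ, f θ ∂betaMeasure 1 1 = ∫ θ in (0 : ℝ)..1, f θ := by
  rw [betaMeasure_one_one, intervalIntegral.integral_of_le zero_le_one,
    integral_Ioc_eq_integral_Ioo]

lemma lintegral_sq_betaMixture_le (hB : 0 ≤ B) (hB1 : B < 1) (s r : ℕ) {p : ℝ}
    (hp : p ∈ Set.Icc 0 1) :
    ∫⁻ θ, ENNReal.ofReal ((θ - p) ^ 2) ∂betaMixture 1 1 B (s + r) s ≤
      ENNReal.ofReal (((r - (1 - B) * (1 - p) * (s + r)) / ((1 - B) * (s + r + 2))) ^ 2 +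
        4 / ((1 - B) * (s + r + 2))) := by
  have hlik : 0 ≤ ∫ θ in (0 : ℝ)..1, likelihood B s r θ :=
    intervalIntegral.integral_nonneg zero_le_one fun θ hθ => likelihood_nonneg hB hB1.le s r hθ
  have hbound := integral_sq_mul_likelihood_le hB hB1 s r hp
  rw [betaMixture_eq_withDensity one_pos one_pos hB (Nat.le_add_right s r),
    Nat.add_sub_cancel_left, integral_betaMeasure_one_one,
    lintegral_withDensity_eq_lintegral_mul _ (by fun_prop) (by fun_prop)]
  set I := ∫ θ in (0 : ℝ)..1, likelihood B s r θ
  calc _ = ∫⁻ θ, ENNReal.ofReal ((θ - p) ^ 2 * likelihood B s r θ / I) ∂betaMeasure 1 1 := by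
        refine lintegral_congr fun θ => ?_
        rw [Pi.mul_apply, mul_comm, ← ENNReal.ofReal_mul (sq_nonneg _), mul_div_assoc]
    _ = ENNReal.ofReal ((∫ θ in (0 : ℝ)..1, (θ - p) ^ 2 * likelihood B s r θ) / I) := by
        rw [← ofReal_integral_eq_lintegral_ofReal
          (integrable_betaMeasure_of_continuous one_pos one_pos (by fun_prop)),
          integral_div, integral_betaMeasure_one_one]
        filter_upwards [ae_mem_Ioo_betaMeasure 1 1] with θ hθ
        have := likelihood_nonneg hB hB1.le s r (Set.Ioo_subset_Icc_self hθ)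
        exact div_nonneg (mul_nonneg (sq_nonneg _) this) hlik
    _ ≤ _ := ENNReal.ofReal_le_ofReal
        (div_le_of_le_mul₀ hlik (by have := sub_pos.2 hB1; positivity) hbound)

end Beta

/-! ### Counts and sums of independent samples -/

section Sample

variable {ι Ω : Type*}

/-- The number of the sample points with an index in `T` that lie in `A`. -/
noncomputable def sampleCount (A : Set Ω) (T : Finset ι) (S : ι → Ω) : ℕ :=
  ∑ k ∈ T, A.indicator 1 (S k)

lemma dependsOn_sampleCount (A : Set Ω) (T : Finset ι) : DependsOn (sampleCount A T) T :=
  fun _ _ h => Finset.sum_congr rfl fun k hk => by rw [h k hk]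

lemma measurable_sampleCount [MeasurableSpace Ω] {A : Set Ω} (hA : MeasurableSet A)
    (T : Finset ι) : Measurable (sampleCount A T) :=
  Finset.measurable_sum _ fun k _ =>
    (measurable_one.indicator hA).comp (measurable_pi_apply k)

lemma sampleCount_insert_of_mem [DecidableEq ι] {A : Set Ω} {T : Finset ι} {S : ι → Ω}
    {i : ι} (hi : i ∉ T) (hS : S i ∈ A) : sampleCount A (insert i T) S = sampleCount A T S + 1 := by
  rw [sampleCount, Finset.sum_insert hi, Set.indicator_of_mem hS, Pi.one_apply, add_comm,
    sampleCount]

variable [Fintype ι] [MeasurableSpace Ω] {μ : Measure Ω} [IsProbabilityMeasure μ]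
  {A : Set Ω} {φ : ℕ → ℝ}

lemma integrable_mul_comp_sampleCount (hA : MeasurableSet A) {a b : ℝ} (hφ : ∀ n, |φ n| ≤ b)
    (T : Finset ι) {H : (ι → Ω) → ℝ} (hH : Measurable H) (hHa : ∀ S, |H S| ≤ a) (m : ℕ) :
    Integrable (fun S => H S * φ (sampleCount A T S + m)) (Measure.pi fun _ : ι => μ) := by
  refine .of_bound (hH.mul (measurable_from_nat.comp
    ((measurable_sampleCount hA T).add_const m))).aestronglyMeasurable (a * b)
    (.of_forall fun S => ?_)
  rw [norm_mul]
  exact mul_le_mul (hHa S) (hφ _) (norm_nonneg _) ((abs_nonneg _).trans (hHa S))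

section Coordinate

variable [DecidableEq ι]

lemma integral_pi_eval_mul_of_dependsOn {i : ι} {g : Ω → ℝ} (hg : Measurable g)
    {H : (ι → Ω) → ℝ} (hH : Measurable H) (hdep : DependsOn H ({i}ᶜ : Finset ι)) :
    ∫ S, g (S i) * H S ∂Measure.pi (fun _ : ι => μ) =
      (∫ z, g z ∂μ) * ∫ S, H S ∂Measure.pi (fun _ : ι => μ) := by
  obtain ⟨z₀⟩ : Nonempty Ω := μ.nonempty_of_neZero
  have hindep : IndepFun (fun S (k : ({i} : Finset ι)) => S k)
      (fun S (k : ({i}ᶜ : Finset ι)) => S k) (Measure.pi fun _ : ι => μ) :=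
    (iIndepFun_pi fun _ => aemeasurable_id).indepFun_finset _ _
      disjoint_compl_right measurable_pi_apply
  let extend (r : ({i}ᶜ : Finset ι) → Ω) (k : ι) : Ω :=
    if hk : k ∈ ({i}ᶜ : Finset ι) then r ⟨k, hk⟩ else z₀
  have hextend : Measurable extend := measurable_pi_lambda _ fun k => by
    by_cases hk : k ∈ ({i}ᶜ : Finset ι)
    · simpa only [extend, dif_pos hk] using measurable_pi_apply _
    · simpa only [extend, dif_neg hk] using measurable_const
  have hfactor : H = fun S => H (extend fun k => S k) := funext fun S => hdep fun k hk => by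
    simp only [extend, dif_pos (Finset.mem_coe.1 hk)]
  have hcoord : Measurable fun r : ({i} : Finset ι) → Ω => g (r ⟨i, Finset.mem_singleton_self i⟩) :=
    hg.comp (measurable_pi_apply _)
  have heval : ∫ S, g (S i) ∂Measure.pi (fun _ : ι => μ) = ∫ z, g z ∂μ :=
    integral_comp_eval (μ := fun _ : ι => μ) hg.aestronglyMeasurable
  rw [← heval, hfactor]
  exact (hindep.comp hcoord (hH.comp hextend)).integral_fun_mul_eq_mul_integral
    (hg.comp (measurable_pi_apply i)).aestronglyMeasurable
    ((hH.comp hextend).comp (by fun_prop)).aestronglyMeasurable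

lemma integral_eval_mul_comp_sampleCount (hA : MeasurableSet A) (φ : ℕ → ℝ) {i : ι} {g : Ω → ℝ}
    (hg : Measurable g) (hgA : ∀ z ∉ A, g z = 0) {H : (ι → Ω) → ℝ} (hH : Measurable H)
    (hdep : DependsOn H ({i}ᶜ : Finset ι)) :
    ∫ S, g (S i) * (H S * φ (sampleCount A .univ S)) ∂Measure.pi (fun _ : ι => μ) =
      (∫ z, g z ∂μ) * ∫ S, H S * φ (sampleCount A {i}ᶜ S + 1) ∂Measure.pi (fun _ : ι => μ) := by
  have hremove (S : ι → Ω) : g (S i) * (H S * φ (sampleCount A .univ S)) =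
      g (S i) * (H S * φ (sampleCount A {i}ᶜ S + 1)) := by
    by_cases hS : S i ∈ A
    · rw [← sampleCount_insert_of_mem (by simp) hS, Finset.insert_compl_self]
    · rw [hgA _ hS, zero_mul, zero_mul]
  simp_rw [hremove]
  refine integral_pi_eval_mul_of_dependsOn hg
    (hH.mul (measurable_from_nat.comp ((measurable_sampleCount hA _).add_const 1)))
    fun S S' h => ?_
  rw [hdep h, dependsOn_sampleCount A _ h]

lemma integral_sampleCount_mul (hA : MeasurableSet A) {b : ℝ} (hφ : ∀ n, |φ n| ≤ b) :
    ∫ S, sampleCount A .univ S * φ (sampleCount A .univ S) ∂Measure.pi (fun _ : ι => μ) =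
      μ.real A * ∑ i, ∫ S, φ (sampleCount A {i}ᶜ S + 1) ∂Measure.pi (fun _ : ι => μ) := by
  have hind : Measurable (A.indicator (1 : Ω → ℝ)) := measurable_one.indicator hA
  have hsum (S : ι → Ω) : (sampleCount A .univ S : ℝ) * φ (sampleCount A .univ S) =
      ∑ i, A.indicator 1 (S i) * (1 * φ (sampleCount A .univ S)) := by
    rw [← Finset.sum_mul, one_mul]
    rw [sampleCount, Nat.cast_sum]
    exact congrArg (· * _) (Finset.sum_congr rfl fun i _ => by by_cases hS : S i ∈ A <;> simp [hS])
  simp_rw [hsum]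
  rw [integral_finsetSum, Finset.mul_sum]
  · refine Finset.sum_congr rfl fun i _ => ?_
    rw [integral_eval_mul_comp_sampleCount hA φ hind (fun z hz => Set.indicator_of_notMem hz _)
      measurable_const ((dependsOn_const _).mono (Set.empty_subset _)), integral_indicator_one hA]
    simp only [one_mul]
  · intro i _
    simp only [one_mul]
    refine integrable_mul_comp_sampleCount (a := 1) hA hφ _
      (hind.comp (measurable_pi_apply i)) (fun S => ?_) 0
    by_cases hS : S i ∈ A <;> simp [hS]

lemma integral_sq_sum_mul (hA : MeasurableSet A) {b : ℝ} (hφ : ∀ n, |φ n| ≤ b) {η : Ω → ℝ}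
    (hη : Measurable η) {a : ℝ} (hηa : ∀ z, |η z| ≤ a) (hηA : ∀ z ∉ A, η z = 0)
    (hmean : ∫ z, η z ∂μ = 0) :
    ∫ S, (∑ i, η (S i)) ^ 2 * φ (sampleCount A .univ S) ∂Measure.pi (fun _ : ι => μ) =
      (∫ z, η z ^ 2 ∂μ) * ∑ i, ∫ S, φ (sampleCount A {i}ᶜ S + 1) ∂Measure.pi (fun _ : ι => μ) := by
  have heval (j : ι) : Measurable fun S : ι → Ω => η (S j) := hη.comp (measurable_pi_apply j)
  have hexpand (S : ι → Ω) : (∑ i, η (S i)) ^ 2 * φ (sampleCount A .univ S) =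
      ∑ i, ∑ j, η (S i) * (η (S j) * φ (sampleCount A .univ S)) := by
    rw [sq, Finset.sum_mul_sum, Finset.sum_mul]
    simp only [Finset.sum_mul, mul_assoc]
  have hint (i j : ι) : Integrable (fun S => η (S i) * (η (S j) * φ (sampleCount A .univ S)))
      (Measure.pi fun _ : ι => μ) := by
    refine (integrable_mul_comp_sampleCount hA hφ _ (heval j) (fun S => hηa (S j)) 0).bdd_mul
      (heval i).aestronglyMeasurable (.of_forall fun S => hηa (S i))
  have hcross {i j : ι} (hij : j ≠ i) :
      ∫ S, η (S i) * (η (S j) * φ (sampleCount A .univ S)) ∂Measure.pi (fun _ : ι => μ) = 0 := by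
    rw [integral_eval_mul_comp_sampleCount hA φ hη hηA (heval j), hmean, zero_mul]
    exact fun S S' h => by simp only [h j (by simpa using hij)]
  simp_rw [hexpand]
  rw [integral_finsetSum _ fun i _ => integrable_finsetSum _ fun j _ => hint i j, Finset.mul_sum]
  refine Finset.sum_congr rfl fun i _ => ?_
  rw [integral_finsetSum _ fun j _ => hint i j,
    Finset.sum_eq_single i (fun j _ hj => hcross hj) (by simp)]
  have hdiag := integral_eval_mul_comp_sampleCount (i := i) (μ := μ) hA φ (hη.pow_const 2)
    (fun z hz => by rw [hηA z hz, zero_pow two_ne_zero])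
    measurable_const ((dependsOn_const (1 : ℝ)).mono (Set.empty_subset _))
  simpa only [one_mul, sq, mul_assoc] using hdiag

end Coordinate

/-- Reweighting by a function of the count keeps centered summands carried by `A` orthogonal, so
only the diagonal of the square remains, and it is compared with the count itself. -/
lemma integral_sq_sum_mul_le (hA : MeasurableSet A) {b : ℝ} (hφ : ∀ n, φ n ∈ Set.Icc 0 b)
    {η : Ω → ℝ} (hη : Measurable η) {a : ℝ} (hηa : ∀ z, |η z| ≤ a) (hηA : ∀ z ∉ A, η z = 0)
    (hmean : ∫ z, η z ∂μ = 0) {c : ℝ} (hc : ∫ z, η z ^ 2 ∂μ ≤ c * μ.real A) :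
    ∫ S, (∑ i, η (S i)) ^ 2 * φ (sampleCount A .univ S) ∂Measure.pi (fun _ : ι => μ) ≤
      c * ∫ S, sampleCount A .univ S * φ (sampleCount A .univ S) ∂Measure.pi (fun _ : ι => μ) := by
  classical
  have hφb (n : ℕ) : |φ n| ≤ b := by rw [abs_of_nonneg (hφ n).1]; exact (hφ n).2
  rw [integral_sq_sum_mul hA hφb hη hηa hηA hmean, integral_sampleCount_mul hA hφb, ← mul_assoc]
  exact mul_le_mul_of_nonneg_right hc
    (Finset.sum_nonneg fun i _ => integral_nonneg fun S => (hφ _).1)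

lemma abs_inv_natCast_le_one (n : ℕ) : |(n : ℝ)⁻¹| ≤ 1 := by
  rw [abs_of_nonneg (by positivity)]
  exact Nat.cast_inv_le_one n

lemma integrable_inv_sampleCount_add_one (hA : MeasurableSet A) (T : Finset ι) :
    Integrable (fun S => ((sampleCount A T S : ℝ) + 1)⁻¹) (Measure.pi fun _ : ι => μ) := by
  simpa using integrable_mul_comp_sampleCount (H := fun _ => 1) (φ := fun n => (n : ℝ)⁻¹) hA
    abs_inv_natCast_le_one T measurable_const (fun _ => abs_one.le) 1

lemma integral_inv_sampleCount_add_one_le (hA : MeasurableSet A) :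
    Fintype.card ι * μ.real A *
      ∫ S, ((sampleCount A .univ S : ℝ) + 1)⁻¹ ∂Measure.pi (fun _ : ι => μ) ≤ 1 := by
  classical
  have hothers (i : ι) : ∫ S, ((sampleCount A .univ S : ℝ) + 1)⁻¹ ∂Measure.pi (fun _ : ι => μ) ≤
      ∫ S, ((sampleCount A {i}ᶜ S + 1 : ℕ) : ℝ)⁻¹ ∂Measure.pi (fun _ : ι => μ) := by
    push_cast
    refine integral_mono (integrable_inv_sampleCount_add_one hA _)
      (integrable_inv_sampleCount_add_one hA _) fun S => ?_
    dsimp only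
    gcongr
    exact Finset.sum_le_sum_of_subset (Finset.subset_univ _)
  calc Fintype.card ι * μ.real A *
        ∫ S, ((sampleCount A .univ S : ℝ) + 1)⁻¹ ∂Measure.pi (fun _ : ι => μ)
      = μ.real A *
          ∑ _i : ι, ∫ S, ((sampleCount A .univ S : ℝ) + 1)⁻¹ ∂Measure.pi fun _ : ι => μ := by
        rw [Finset.sum_const, Finset.card_univ, nsmul_eq_mul]; ring
    _ ≤ μ.real A * ∑ i, ∫ S, ((sampleCount A {i}ᶜ S + 1 : ℕ) : ℝ)⁻¹ ∂Measure.pi fun _ : ι => μ :=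
        mul_le_mul_of_nonneg_left (Finset.sum_le_sum fun i _ => hothers i) measureReal_nonneg
    _ = ∫ S, sampleCount A .univ S * (sampleCount A .univ S : ℝ)⁻¹ ∂Measure.pi fun _ : ι => μ :=
        (integral_sampleCount_mul (φ := fun n => (n : ℝ)⁻¹) hA abs_inv_natCast_le_one).symm
    _ ≤ 1 := by
        refine (integral_mono_of_nonneg (.of_forall fun S => by positivity)
          (integrable_const (1 : ℝ)) (.of_forall fun S => mul_inv_le_one)).trans_eq ?_
        simp

lemma inv_sq_natCast_add_two_mem_Icc (n : ℕ) : (((n : ℝ) + 2) ^ 2)⁻¹ ∈ Set.Icc 0 1 :=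
  ⟨by positivity, inv_le_one_of_one_le₀ (one_le_pow₀ (by linarith [n.cast_nonneg (α := ℝ)]))⟩

lemma integrable_sq_sum_div_sampleCount (hA : MeasurableSet A) {η : Ω → ℝ} (hη : Measurable η)
    {a : ℝ} (hηa : ∀ z, |η z| ≤ a) :
    Integrable (fun S => (∑ i, η (S i)) ^ 2 / (sampleCount A .univ S + 2) ^ 2)
      (Measure.pi fun _ : ι => μ) := by
  have hsum (S : ι → Ω) : |(∑ i, η (S i)) ^ 2| ≤ (∑ _i : ι, a) ^ 2 := by
    rw [abs_pow]
    exact pow_le_pow_left₀ (abs_nonneg _)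
      ((Finset.abs_sum_le_sum_abs _ _).trans (Finset.sum_le_sum fun i _ => hηa _)) 2
  simp_rw [div_eq_mul_inv]
  exact integrable_mul_comp_sampleCount (φ := fun n => (((n : ℝ) + 2) ^ 2)⁻¹) hA
    (fun n => (abs_of_nonneg (inv_sq_natCast_add_two_mem_Icc n).1).trans_le
      (inv_sq_natCast_add_two_mem_Icc n).2) _ (by fun_prop) hsum 0

lemma integral_sq_sum_div_sampleCount_le (hA : MeasurableSet A) {η : Ω → ℝ} (hη : Measurable η)
    {a : ℝ} (hηa : ∀ z, |η z| ≤ a) (hηA : ∀ z ∉ A, η z = 0) (hmean : ∫ z, η z ∂μ = 0) {c : ℝ}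
    (hc0 : 0 ≤ c) (hc : ∫ z, η z ^ 2 ∂μ ≤ c * μ.real A) :
    ∫ S, (∑ i, η (S i)) ^ 2 / (sampleCount A .univ S + 2) ^ 2 ∂Measure.pi (fun _ : ι => μ) ≤
      c * ∫ S, ((sampleCount A .univ S : ℝ) + 1)⁻¹ ∂Measure.pi (fun _ : ι => μ) := by
  have hle (n : ℕ) : (n : ℝ) * (((n : ℝ) + 2) ^ 2)⁻¹ ≤ ((n : ℝ) + 1)⁻¹ := by
    rw [← div_eq_mul_inv, inv_eq_one_div, div_le_div_iff₀ (by positivity) (by positivity)]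
    nlinarith [n.cast_nonneg (α := ℝ)]
  refine (integral_sq_sum_mul_le hA inv_sq_natCast_add_two_mem_Icc hη hηa hηA hmean hc).trans
    (mul_le_mul_of_nonneg_left (integral_mono_of_nonneg (.of_forall fun S => ?_)
      (integrable_inv_sampleCount_add_one hA _) (.of_forall fun S => hle _)) hc0)
  exact mul_nonneg (Nat.cast_nonneg _) (inv_sq_natCast_add_two_mem_Icc _).1

end Sample

/-! ### Experiments -/

section Experiment

variable {d : ℕ} {π : Cube d → ℝ} {B : ℝ}

lemma one_sub_successProb (π : Cube d → ℝ) (B : ℝ) (x : Cube d) :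
    1 - successProb π B x = (1 - B) * (1 - π x) := by
  unfold successProb
  ring

lemma successProb_mem_Icc (hB : B ∈ Set.Icc 0 1) {x : Cube d} (hπ : π x ∈ Set.Icc 0 1) :
    successProb π B x ∈ Set.Icc 0 1 := by
  refine ⟨add_nonneg (mul_nonneg (sub_nonneg.2 hB.2) hπ.1) hB.1, sub_nonneg.1 ?_⟩
  rw [one_sub_successProb]
  exact mul_nonneg (sub_nonneg.2 hB.2) (sub_nonneg.2 hπ.2)

lemma measurable_successProb (hm : Measurable π) (B : ℝ) : Measurable (successProb π B) := by
  unfold successProb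
  fun_prop

lemma measurable_experimentDensity (hm : Measurable π) (B : ℝ) :
    Measurable fun z : Cube d × Bool =>
      if z.2 = true then successProb π B z.1 else 1 - successProb π B z.1 := by
  have h := measurable_successProb hm B
  exact Measurable.ite (measurable_snd (measurableSet_singleton true)) (by fun_prop) (by fun_prop)

lemma isProbabilityMeasure_experimentLaw (hm : Measurable π)
    (hp : ∀ x, successProb π B x ∈ Set.Icc 0 1) : IsProbabilityMeasure (experimentLaw π B) := by
  have htotal (x : Cube d) :
      ENNReal.ofReal (successProb π B x) + ENNReal.ofReal (1 - successProb π B x) = 1 := by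
    rw [← ENNReal.ofReal_add (hp x).1 (sub_nonneg.2 (hp x).2), add_sub_cancel, ENNReal.ofReal_one]
  constructor
  rw [experimentLaw, withDensity_apply _ MeasurableSet.univ, setLIntegral_univ,
    lintegral_prod _ (measurable_experimentDensity hm B).ennreal_ofReal.aemeasurable]
  simp [lintegral_count, htotal]

lemma integral_experimentLaw (hm : Measurable π) (hp : ∀ x, successProb π B x ∈ Set.Icc 0 1)
    {f : Cube d × Bool → ℝ} (hf : Integrable f (volume.prod Measure.count)) :
    ∫ z, f z ∂experimentLaw π B =
      ∫ x, (successProb π B x * f (x, true) + (1 - successProb π B x) * f (x, false)) := by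
  have hdensity (z : Cube d × Bool) :
      (if z.2 = true then successProb π B z.1 else 1 - successProb π B z.1) ∈
        Set.Icc (0 : ℝ) 1 := by
    split_ifs
    exacts [hp _, Set.Icc.one_sub_mem (hp _)]
  have hmeas := measurable_experimentDensity hm B
  rw [experimentLaw, integral_withDensity_eq_integral_toReal_smul hmeas.ennreal_ofReal
    (.of_forall fun _ => ENNReal.ofReal_lt_top)]
  simp_rw [ENNReal.toReal_ofReal (hdensity _).1, smul_eq_mul]
  rw [integral_prod]
  · simp [integral_count]
  · refine hf.bdd_mul hmeas.aestronglyMeasurable (.of_forall fun z => ?_) (c := 1)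
    rw [Real.norm_of_nonneg (hdensity z).1]
    exact (hdensity z).2

lemma experimentLaw_real_fst_preimage (hm : Measurable π)
    (hp : ∀ x, successProb π B x ∈ Set.Icc 0 1) {U : Set (Cube d)} (hU : MeasurableSet U) :
    (experimentLaw π B).real (Prod.fst ⁻¹' U) = volume.real U := by
  have hint : Integrable ((Prod.fst ⁻¹' U).indicator (1 : Cube d × Bool → ℝ))
      (volume.prod Measure.count) := (integrable_const 1).indicator (measurable_fst hU)
  rw [← integral_indicator_one (measurable_fst hU), integral_experimentLaw hm hp hint,
    ← integral_indicator_one hU]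
  refine integral_congr_ae (.of_forall fun y => ?_)
  by_cases hy : y ∈ U <;> simp [hy]

/-- The centered indicator of a failure, restricted to the test points in `U`: the part of the
failure count that the success probability does not predict. -/
noncomputable def failureNoise (π : Cube d → ℝ) (B : ℝ) (U : Set (Cube d)) :
    Cube d × Bool → ℝ :=
  (Prod.fst ⁻¹' U).indicator fun z => (if z.2 = true then 0 else 1) - (1 - successProb π B z.1)

lemma measurable_failureNoise (hm : Measurable π) (B : ℝ) {U : Set (Cube d)}
    (hU : MeasurableSet U) : Measurable (failureNoise π B U) := by
  have h := measurable_successProb hm B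
  exact ((Measurable.ite (measurable_snd (measurableSet_singleton true)) measurable_const
    measurable_const).sub (by fun_prop)).indicator (measurable_fst hU)

lemma abs_failureNoise_le_one (hp : ∀ x, successProb π B x ∈ Set.Icc 0 1) (U : Set (Cube d))
    (z : Cube d × Bool) : |failureNoise π B U z| ≤ 1 := by
  obtain ⟨h₀, h₁⟩ := hp z.1
  by_cases hz : z ∈ Prod.fst ⁻¹' U
  · rw [failureNoise, Set.indicator_of_mem hz, abs_le]
    split_ifs <;> constructor <;> linarith
  · simp [failureNoise, hz]

lemma integral_failureNoise (hm : Measurable π) (hp : ∀ x, successProb π B x ∈ Set.Icc 0 1)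
    {U : Set (Cube d)} (hU : MeasurableSet U) :
    ∫ z, failureNoise π B U z ∂experimentLaw π B = 0 := by
  rw [integral_experimentLaw hm hp (.of_bound (measurable_failureNoise hm B hU).aestronglyMeasurable
    1 (.of_forall (abs_failureNoise_le_one hp U))), ← integral_zero (Cube d) ℝ]
  refine integral_congr_ae (.of_forall fun y => ?_)
  by_cases hy : y ∈ U <;> simp [failureNoise, hy]
  ring

lemma integral_sq_failureNoise_le (hm : Measurable π) (hp : ∀ x, successProb π B x ∈ Set.Icc 0 1)
    {U : Set (Cube d)} (hU : MeasurableSet U) {b : ℝ} (hb : ∀ x, 1 - successProb π B x ≤ b) :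
    ∫ z, failureNoise π B U z ^ 2 ∂experimentLaw π B ≤ b * volume.real U := by
  have hint : Integrable (fun z => failureNoise π B U z ^ 2) (volume.prod Measure.count) :=
    .of_bound ((measurable_failureNoise hm B hU).pow_const 2).aestronglyMeasurable 1
      (.of_forall fun z => by
        rw [norm_pow]
        exact pow_le_one₀ (norm_nonneg _) (abs_failureNoise_le_one hp U z))
  have hvar (y : Cube d) : successProb π B y * failureNoise π B U (y, true) ^ 2 +
      (1 - successProb π B y) * failureNoise π B U (y, false) ^ 2 =
      U.indicator (fun y => successProb π B y * (1 - successProb π B y)) y := by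
    by_cases hy : y ∈ U <;> simp [failureNoise, hy]
    ring
  rw [integral_experimentLaw hm hp hint, ← integral_indicator_one hU, ← integral_const_mul]
  simp_rw [hvar]
  refine integral_mono_of_nonneg (.of_forall fun y => Set.indicator_nonneg
      (fun y _ => mul_nonneg (hp y).1 (sub_nonneg.2 (hp y).2)) y)
    (((integrable_const 1).indicator hU).const_mul b) (.of_forall fun y => ?_)
  by_cases hy : y ∈ U
  · simp only [Set.indicator_of_mem hy, Pi.one_apply, mul_one]
    exact (mul_le_of_le_one_left (sub_nonneg.2 (hp y).2) (hp y).2).trans (hb y)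
  · simp only [Set.indicator_of_notMem hy, mul_zero, le_refl]

end Experiment

section Neighbors

variable {d t : ℕ} {Δ : ℝ} {S : Data d t} {x : Cube d}

lemma mem_neighbors_iff (hΔ : 0 ≤ Δ) {i : Fin t} :
    i ∈ neighbors Δ S x ↔ S i ∈ Prod.fst ⁻¹' Metric.closedBall x Δ := by
  simp only [neighbors, Finset.mem_filter_univ, Set.mem_preimage, Metric.mem_closedBall',
    dist_pi_le_iff hΔ]
  rfl

lemma sum_indicator_eq_sum_neighbors (hΔ : 0 ≤ Δ) (f : Cube d × Bool → ℝ) :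
    ∑ i, (Prod.fst ⁻¹' Metric.closedBall x Δ).indicator f (S i) =
      ∑ i ∈ neighbors Δ S x, f (S i) := by
  classical
  simp_rw [Set.indicator_apply, ← mem_neighbors_iff hΔ, ← Finset.sum_filter,
    Finset.filter_univ_mem]

lemma numNear_eq_sampleCount (hΔ : 0 ≤ Δ) :
    numNear Δ S x = sampleCount (Prod.fst ⁻¹' Metric.closedBall x Δ) .univ S := by
  classical
  simp_rw [sampleCount, Set.indicator_apply, ← mem_neighbors_iff hΔ, Pi.one_apply, numNear,
    Finset.card_eq_sum_ones, ← Finset.sum_filter, Finset.filter_univ_mem]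

/-- The number of failures among the experiments in the box around `x`. -/
noncomputable def numFail (Δ : ℝ) (S : Data d t) (x : Cube d) : ℕ :=
  ((neighbors Δ S x).filter fun i => ¬(S i).2 = true).card

lemma numSucc_add_numFail (Δ : ℝ) (S : Data d t) (x : Cube d) :
    numSucc Δ S x + numFail Δ S x = numNear Δ S x :=
  Finset.card_filter_add_card_filter_not _

lemma numFail_sub_eq_sum (hΔ : 0 ≤ Δ) (π : Cube d → ℝ) (B p : ℝ) :
    (numFail Δ S x : ℝ) - (1 - B) * (1 - p) * numNear Δ S x =
      ∑ i, failureNoise π B (Metric.closedBall x Δ) (S i) +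
        (1 - B) * ∑ i ∈ neighbors Δ S x, (p - π (S i).1) := by
  simp only [failureNoise, sum_indicator_eq_sum_neighbors hΔ, one_sub_successProb,
    Finset.sum_sub_distrib, ← Finset.mul_sum, Finset.sum_const, nsmul_eq_mul, numNear, numFail,
    Finset.natCast_card_filter, ite_not]
  ring

end Neighbors

/-! ### The mean squared error -/

section Risk

variable {d t : ℕ} {π : Cube d → ℝ} {B Δ ε : ℝ} {x : Cube d}

lemma sq_div_add_two_le {c n z D : ℝ} (hc : 0 < c) (hn : 0 ≤ n) (hD : |D| ≤ n * ε) :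
    ((z + c * D) / (c * (n + 2))) ^ 2 ≤ 2 * ε ^ 2 + 2 / c ^ 2 * (z ^ 2 / (n + 2) ^ 2) := by
  have hbias : |D / (n + 2)| ≤ |ε| := by
    rw [abs_div, abs_of_pos (by positivity : 0 < n + 2), div_le_iff₀ (by positivity)]
    nlinarith [le_abs_self ε, abs_nonneg ε]
  calc ((z + c * D) / (c * (n + 2))) ^ 2 = (D / (n + 2) + z / (c * (n + 2))) ^ 2 := by
        field_simp
        ring
    _ ≤ 2 * ((D / (n + 2)) ^ 2 + (z / (c * (n + 2))) ^ 2) := add_sq_le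
    _ ≤ 2 * (ε ^ 2 + (z / (c * (n + 2))) ^ 2) := by linarith [sq_le_sq.2 hbias]
    _ = 2 * ε ^ 2 + 2 / c ^ 2 * (z ^ 2 / (n + 2) ^ 2) := by
        field_simp

lemma lintegral_sq_posterior_le (hB : 0 ≤ B) (hB1 : B < 1) (hπx : π x ∈ Set.Icc 0 1) (hΔ : 0 ≤ Δ)
    (hε : ∀ y ∈ Metric.closedBall x Δ, |π x - π y| ≤ ε) (S : Data d t) :
    ∫⁻ θ, ENNReal.ofReal ((θ - π x) ^ 2) ∂posterior 1 1 B Δ S x ≤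
      ENNReal.ofReal (2 * ε ^ 2 + 2 / (1 - B) ^ 2 *
          ((∑ i, failureNoise π B (Metric.closedBall x Δ) (S i)) ^ 2 / (numNear Δ S x + 2) ^ 2) +
        4 / (1 - B) * ((numNear Δ S x : ℝ) + 1)⁻¹) := by
  have hB1' : 0 < 1 - B := sub_pos.2 hB1
  have hcount := numSucc_add_numFail Δ S x
  have hcount' : (numSucc Δ S x : ℝ) + numFail Δ S x = numNear Δ S x := mod_cast hcount
  have hbias : |∑ i ∈ neighbors Δ S x, (π x - π (S i).1)| ≤ numNear Δ S x * ε := by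
    rw [numNear, ← nsmul_eq_mul]
    exact (Finset.abs_sum_le_sum_abs _ _).trans (Finset.sum_le_card_nsmul _ _ _
      fun i hi => hε _ ((mem_neighbors_iff hΔ).1 hi))
  have hpost := lintegral_sq_betaMixture_le hB hB1 (numSucc Δ S x) (numFail Δ S x) hπx
  rw [hcount, hcount', numFail_sub_eq_sum hΔ] at hpost
  refine hpost.trans (ENNReal.ofReal_le_ofReal
    (add_le_add (sq_div_add_two_le hB1' (Nat.cast_nonneg _) hbias) ?_))
  rw [← div_div, ← div_eq_mul_inv]
  gcongr
  norm_num

lemma meanSquareError_le (hB : 0 ≤ B) (hB1 : B < 1) (hm : Measurable π)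
    (hπ : ∀ x, π x ∈ Set.Icc 0 1) (hΔ : 0 ≤ Δ)
    (hε : ∀ y ∈ Metric.closedBall x Δ, |π x - π y| ≤ ε) (ht : 0 < t)
    (hvol : 0 < volume.real (Metric.closedBall x Δ)) :
    meanSquareError π B Δ t x ≤ ENNReal.ofReal
      (2 * ε ^ 2 + 6 / ((1 - B) * t * volume.real (Metric.closedBall x Δ))) := by
  have hB1' : 0 < 1 - B := sub_pos.2 hB1
  have hp (y : Cube d) : successProb π B y ∈ Set.Icc 0 1 := successProb_mem_Icc ⟨hB, hB1.le⟩ (hπ y)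
  have hprob := isProbabilityMeasure_experimentLaw hm hp
  have hU : MeasurableSet (Metric.closedBall x Δ) := Metric.isClosed_closedBall.measurableSet
  have hA : MeasurableSet (Prod.fst ⁻¹' Metric.closedBall x Δ : Set (Cube d × Bool)) :=
    measurable_fst hU
  have hreal := experimentLaw_real_fst_preimage hm hp hU
  have hη := measurable_failureNoise hm B hU
  have hfail (y : Cube d) : 1 - successProb π B y ≤ 1 - B := by
    rw [one_sub_successProb]
    exact mul_le_of_le_one_right hB1'.le (sub_le_self _ (hπ y).1)
  have hnoise := integral_sq_sum_div_sampleCount_le (ι := Fin t) hA hη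
    (abs_failureNoise_le_one hp _) (fun z hz => Set.indicator_of_notMem hz _)
    (integral_failureNoise hm hp hU) hB1'.le
    ((integral_sq_failureNoise_le hm hp hU hfail).trans_eq (congrArg _ hreal.symm))
  have hinv := integral_inv_sampleCount_add_one_le (ι := Fin t) (μ := experimentLaw π B) hA
  rw [Fintype.card_fin, hreal] at hinv
  have hint := integrable_inv_sampleCount_add_one (ι := Fin t) (μ := experimentLaw π B) hA .univ
  have hint' := integrable_sq_sum_div_sampleCount (ι := Fin t) (μ := experimentLaw π B) hA hη
    (abs_failureNoise_le_one hp _)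
  refine (lintegral_mono (lintegral_sq_posterior_le hB hB1 (hπ x) hΔ hε)).trans ?_
  simp_rw [numNear_eq_sampleCount hΔ, dataLaw]
  rw [← ofReal_integral_eq_lintegral_ofReal (by fun_prop) (.of_forall fun S => by positivity),
    integral_add (by fun_prop) (by fun_prop), integral_add (by fun_prop) (by fun_prop),
    integral_const, probReal_univ, one_smul, integral_const_mul, integral_const_mul, add_assoc]
  refine ENNReal.ofReal_le_ofReal (add_le_add_right ?_ _)
  set E := ∫ S, ((sampleCount (Prod.fst ⁻¹' Metric.closedBall x Δ) .univ S : ℝ) + 1)⁻¹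
    ∂Measure.pi fun _ : Fin t => experimentLaw π B
  calc _ ≤ 2 / (1 - B) ^ 2 * ((1 - B) * E) + 4 / (1 - B) * E := by gcongr
    _ = 6 / (1 - B) * E := by field_simp; ring
    _ ≤ 6 / (1 - B) * (1 / (t * volume.real (Metric.closedBall x Δ))) := by
        gcongr
        rwa [le_div_iff₀' (by positivity)]
    _ = 6 / ((1 - B) * t * volume.real (Metric.closedBall x Δ)) := by field_simp

end Risk

section Rate

variable {d : ℕ}

lemma ofReal_min_one_le_volume_closedBall {Δ : ℝ} (hΔ : 0 ≤ Δ) (x : unitInterval) :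
    ENNReal.ofReal (min Δ 1) ≤ volume (Metric.closedBall x Δ) := by
  have hm0 : 0 ≤ min Δ 1 := le_min hΔ zero_le_one
  have hm1 : min Δ 1 ≤ 1 := min_le_right _ _
  obtain ⟨hx0, hx1⟩ := x.2
  let l : unitInterval := ⟨min x (1 - min Δ 1), le_min hx0 (sub_nonneg.2 hm1),
    (min_le_left _ _).trans hx1⟩
  let u : unitInterval := ⟨l + min Δ 1, add_nonneg l.2.1 hm0,
    by linarith [(min_le_right _ _ : (l : ℝ) ≤ 1 - min Δ 1)]⟩
  have hlen : (u : ℝ) - l = min Δ 1 := add_sub_cancel_left _ _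
  have hx : (x : ℝ) ∈ Set.Icc (l : ℝ) u :=
    ⟨min_le_left _ _, by
      change (x : ℝ) ≤ min (x : ℝ) (1 - min Δ 1) + min Δ 1
      rw [← min_add_add_right, sub_add_cancel]
      exact le_min (le_add_of_nonneg_right hm0) hx1⟩
  have hball : Set.Icc l u ⊆ Metric.closedBall x Δ := fun y hy => by
    refine (Real.dist_le_of_mem_Icc (show (y : ℝ) ∈ Set.Icc (l : ℝ) u from hy) hx).trans ?_
    exact hlen.trans_le (min_le_left _ _)
  refine le_trans (le_of_eq ?_) (measure_mono hball)
  rw [unitInterval.volume_Icc, hlen]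

lemma min_one_pow_le_volume_closedBall {Δ : ℝ} (hΔ : 0 ≤ Δ) (x : Cube d) :
    min Δ 1 ^ d ≤ volume.real (Metric.closedBall x Δ) := by
  have h0 : 0 ≤ min Δ 1 := le_min hΔ zero_le_one
  rw [measureReal_def, ← ENNReal.ofReal_le_iff_le_toReal (measure_ne_top _ _),
    closedBall_pi _ hΔ, volume_pi_pi, ENNReal.ofReal_pow h0]
  calc ENNReal.ofReal (min Δ 1) ^ d = ∏ _j : Fin d, ENNReal.ofReal (min Δ 1) := by simp
    _ ≤ _ := Finset.prod_le_prod' fun j _ => ofReal_min_one_le_volume_closedBall hΔ (x j)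

lemma seminorm_le_sum_mul_norm {ι : Type*} [Fintype ι] [DecidableEq ι]
    (N : Seminorm ℝ (ι → ℝ)) (v : ι → ℝ) : N v ≤ (∑ j, N (Pi.single j 1)) * ‖v‖ := by
  calc N v = N (∑ j, v j • (Pi.single j 1 : ι → ℝ)) := by rw [← pi_eq_sum_univ' v]
    _ ≤ ∑ j, N (v j • (Pi.single j 1 : ι → ℝ)) :=
        Finset.le_sum_of_subadditive N (map_zero N).le (map_add_le_add N) _ _
    _ ≤ ∑ j, N (Pi.single j 1) * ‖v‖ := by
        refine Finset.sum_le_sum fun j _ => ?_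
        rw [map_smul_eq_mul, mul_comm]
        exact mul_le_mul_of_nonneg_left (norm_le_pi_norm v j) (apply_nonneg N _)
    _ = _ := (Finset.sum_mul _ _ _).symm

lemma norm_vec_sub_vec (x y : Cube d) : ‖x.vec - y.vec‖ = dist x y := by
  rw [← dist_eq_norm]
  rfl

lemma kernelWidth_eq (d : ℕ) {κ L B : ℝ} (hL : 0 ≤ L) (hB : B ≤ 1) (t : ℕ) :
    kernelWidth d κ L B t = κ / (L ^ 2 * ((1 - B) * t)) ^ (1 / ((d : ℝ) + 2)) := by
  have hT : 0 ≤ (1 - B) * t := mul_nonneg (sub_nonneg.2 hB) t.cast_nonneg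
  rw [kernelWidth, Real.mul_rpow (by positivity) hT, ← Real.rpow_natCast L 2, ← Real.rpow_mul hL,
    neg_div, neg_div, Real.rpow_neg hL, Real.rpow_neg hT, mul_assoc, ← mul_inv, div_eq_mul_inv κ]
  congr 5
  push_cast
  ring

lemma rate_eq (d : ℕ) {L T : ℝ} (hL : 0 < L) (hT : 0 ≤ T) :
    L ^ (2 * (d : ℝ) / ((d : ℝ) + 2)) * T ^ (-(2 : ℝ) / ((d : ℝ) + 2)) =
      L ^ 2 / ((L ^ 2 * T) ^ (1 / ((d : ℝ) + 2))) ^ 2 := by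
  rw [← Real.rpow_mul_natCast (by positivity), Real.mul_rpow (by positivity) hT,
    ← Real.rpow_natCast L 2, ← Real.rpow_mul hL.le, neg_div, Real.rpow_neg hT, ← div_eq_mul_inv,
    ← div_div, ← Real.rpow_sub hL]
  congr 2
  · push_cast
    field_simp
    ring
  · push_cast
    ring

lemma meanSquareError_of_lipschitz_le {π : Cube d → ℝ} {B : ℝ} (hB : 0 ≤ B) (hB1 : B < 1)
    (hπ : ∀ x, π x ∈ Set.Icc 0 1) {K : NNReal} (hLip : LipschitzWith K π) {Δ : ℝ} (hΔ : 0 < Δ)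
    {t : ℕ} (ht : 0 < t) (x : Cube d) :
    meanSquareError π B Δ t x ≤
      ENNReal.ofReal (2 * (K * Δ) ^ 2 + 6 / ((1 - B) * t * min Δ 1 ^ d)) := by
  have := sub_pos.2 hB1
  have hbias (y) (hy : y ∈ Metric.closedBall x Δ) : |π x - π y| ≤ K * Δ :=
    (hLip.dist_le_mul x y).trans (by gcongr; exact Metric.mem_closedBall'.1 hy)
  have hpow : 0 < min Δ 1 ^ d := pow_pos (lt_min hΔ one_pos) d
  have hvol := min_one_pow_le_volume_closedBall hΔ.le x
  refine (meanSquareError_le hB hB1 hLip.continuous.measurable hπ hΔ.le hbias ht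
    (hpow.trans_le hvol)).trans (ENNReal.ofReal_le_ofReal ?_)
  gcongr

theorem supMeanSquareError_kernelWidth_le (N : Seminorm ℝ (Fin d → ℝ)) {κ : ℝ} (hκ : 0 < κ) :
    ∃ C : ℝ, 0 < C ∧ ∀ L B : ℝ, 0 < L → 0 ≤ B → B < 1 →
      ∀ π : Cube d → ℝ, (∀ x, π x ∈ Set.Icc 0 1) →
      (∀ x y, |π x - π y| ≤ L * N (x.vec - y.vec)) →
      ∀ t : ℕ, 1 ≤ L ^ 2 * ((1 - B) * t) →
        supMeanSquareError π B (kernelWidth d κ L B t) t ≤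
          ENNReal.ofReal (C * (L ^ (2 * (d : ℝ) / ((d : ℝ) + 2)) *
            ((1 - B) * t) ^ (-(2 : ℝ) / ((d : ℝ) + 2)))) := by
  set A : ℝ := ∑ j, N (Pi.single j 1)
  have : 0 ≤ A := Finset.sum_nonneg fun j _ => apply_nonneg N _
  have : 0 < min κ 1 := lt_min hκ one_pos
  refine ⟨2 * (A * κ) ^ 2 + 6 / min κ 1 ^ d, by positivity, ?_⟩
  intro L B hL hB hB1 π hπ hN t hLt
  have hT : 0 < (1 - B) * t := pos_of_mul_pos_right (one_pos.trans_le hLt) (sq_nonneg L)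
  have ht : 0 < t := Nat.cast_pos.1 (pos_of_mul_pos_right hT (sub_nonneg.2 hB1.le))
  have hLip : LipschitzWith (L * A).toNNReal π := .of_dist_le_mul fun x y => by
    rw [Real.coe_toNNReal _ (by positivity), ← norm_vec_sub_vec, mul_assoc]
    exact (hN x y).trans (by gcongr; exact seminorm_le_sum_mul_norm N _)
  set y : ℝ := (L ^ 2 * ((1 - B) * t)) ^ (1 / ((d : ℝ) + 2)) with hy
  have hy1 : 1 ≤ y := Real.one_le_rpow hLt (by positivity)
  have hypow : (1 - B) * t = y ^ (d + 2) / L ^ 2 := by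
    rw [hy, ← Real.rpow_mul_natCast (by positivity)]
    push_cast
    rw [one_div_mul_cancel (by positivity), Real.rpow_one, mul_div_cancel_left₀ _ (by positivity)]
  have hmin : min κ 1 / y ≤ min (κ / y) 1 :=
    le_min (by gcongr; exact min_le_left _ _) ((div_le_one (by positivity)).2
      ((min_le_right _ _).trans hy1))
  rw [rate_eq d hL hT.le, ← hy, kernelWidth_eq d hL.le hB1.le, ← hy]
  refine iSup_le fun x => (meanSquareError_of_lipschitz_le hB hB1 hπ hLip (by positivity) ht
    x).trans (ENNReal.ofReal_le_ofReal ?_)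
  calc _ ≤ 2 * (L * A * (κ / y)) ^ 2 + 6 / ((1 - B) * t * (min κ 1 / y) ^ d) := by
        rw [Real.coe_toNNReal _ (by positivity)]
        gcongr
    _ = _ := by
        rw [hypow, div_pow]
        field_simp
        ring

end Rate

/-! ### The program -/

section Semantics

attribute [simp] NExp.eval NExp.cost RExp.eval RExp.cost Cmd.run scalar pointCoord

variable {V A : Type}

@[simp]
lemma Store.nat_setNat [DecidableEq V] (σ : Store V A) (v w : V) (k : ℕ) :
    (σ.setNat v k).nat w = if w = v then k else σ.nat w :=
  Function.update_apply ..

@[simp]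
lemma Store.arr_setNat [DecidableEq V] (σ : Store V A) (v : V) (k : ℕ) :
    (σ.setNat v k).arr = σ.arr :=
  rfl

@[simp]
lemma Store.nat_setArr [DecidableEq A] (σ : Store V A) (a : A) (i : ℕ) (r : ℝ) :
    (σ.setArr a i r).nat = σ.nat :=
  rfl

lemma Store.arr_setArr_of_ne [DecidableEq A] (σ : Store V A) {a b : A} (h : b ≠ a) (i : ℕ)
    (r : ℝ) : (σ.setArr a i r).arr b = σ.arr b :=
  Function.update_of_ne h _ _

@[simp]
lemma Store.arr_setArr [DecidableEq A] (σ : Store V A) (a b : A) (i j : ℕ) (r : ℝ) :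
    (σ.setArr a i r).arr b j = if b = a ∧ j = i then r else σ.arr b j := by
  by_cases h : b = a
  · simp [Store.setArr, h, Function.update_apply]
  · simp [σ.arr_setArr_of_ne h, h]

lemma runLoop_invariant {step : ℕ → Store V A → Store V A × ℕ} {I : ℕ → Store V A → Prop}
    {m b : ℕ} {σ : Store V A} (h₀ : I 0 σ)
    (hstep : ∀ k < m, ∀ τ, I k τ → I (k + 1) (step k τ).1 ∧ (step k τ).2 ≤ b) :
    I m (runLoop step m σ).1 ∧ (runLoop step m σ).2 ≤ m * (b + 1) := by
  induction m with
  | zero => exact ⟨h₀, by simp only [runLoop, zero_mul, le_refl]⟩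
  | succ m ih =>
    obtain ⟨hI, htime⟩ := ih fun k hk => hstep k (hk.trans m.lt_succ_self)
    obtain ⟨hI', htime'⟩ := hstep m m.lt_succ_self _ hI
    refine ⟨hI', ?_⟩
    simp only [runLoop]
    linarith [add_one_mul m (b + 1)]

variable [DecidableEq V] [DecidableEq A]

/-- Timed total correctness: started in the memory `σ`, the command `c` takes at most `b` units
of time and leaves a memory that satisfies `Q`. -/
def Cmd.Ensures (c : Cmd V A) (b : ℕ) (Q : Store V A → Prop) (σ : Store V A) : Prop :=
  Q (c.run σ).1 ∧ (c.run σ).2 ≤ b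

namespace Cmd.Ensures

variable {c c' : Cmd V A} {b b' : ℕ} {Q R : Store V A → Prop} {σ : Store V A}

lemma mono (h : c.Ensures b Q σ) (hQ : ∀ τ, Q τ → R τ) (hb : b ≤ b') : c.Ensures b' R σ :=
  ⟨hQ _ h.1, h.2.trans hb⟩

lemma setN {v : V} {e : NExp V} (h : Q (σ.setNat v (e.eval σ))) :
    (Cmd.setN v e).Ensures (e.cost + 1) Q σ :=
  ⟨h, le_rfl⟩

lemma setR {a : A} {i : NExp V} {e : RExp V A} (h : Q (σ.setArr a (i.eval σ) (e.eval σ))) :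
    (Cmd.setR a i e).Ensures (i.cost + e.cost + 1) Q σ :=
  ⟨h, le_rfl⟩

lemma seq (h : c.Ensures b Q σ) (h' : ∀ τ, Q τ → c'.Ensures b' R τ) :
    (Cmd.seq c c').Ensures (b + b') R σ :=
  ⟨(h' _ h.1).1, Nat.add_le_add h.2 (h' _ h.1).2⟩

lemma loop {v : V} {e : NExp V} {m : ℕ} {I : ℕ → Store V A → Prop} (hm : e.eval σ = m)
    (h₀ : I 0 σ) (hstep : ∀ k < m, ∀ τ, I k τ → c.Ensures b (I (k + 1)) (τ.setNat v k)) :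
    (Cmd.loop v e c).Ensures (e.cost + 1 + m * (b + 1)) (I m) σ := by
  subst hm
  obtain ⟨hI, htime⟩ := runLoop_invariant (step := fun k τ => c.run (τ.setNat v k)) h₀ hstep
  exact ⟨hI, Nat.add_le_add_left htime _⟩

end Cmd.Ensures

end Semantics

section Scan

/-- The arrays that hold the input of the algorithm, which the program only reads. -/
def Arr.isInput : Arr → Bool
  | .point | .outcome | .query | .context | .priorA | .priorB | .lipschitz | .kappa => true
  | _ => false

lemma arr_setArr_of_isInput {σ : Memory} {a : Arr} (ha : a.isInput = false) (b : Arr)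
    (hb : b.isInput = true) (i : ℕ) (r : ℝ) : (σ.setArr a i r).arr b = σ.arr b :=
  σ.arr_setArr_of_ne (fun hba => by simp [← hba, hb] at ha) i r

variable {d t : ℕ} {σ : Memory} {κ L B α β Δ : ℝ} {S : Data d t} {x : Cube d} {n s : ℕ}

lemma HoldsInput.setArr (h : HoldsInput σ κ L B α β S x) {a : Arr} (ha : a.isInput = false)
    (i : ℕ) (r : ℝ) : HoldsInput (σ.setArr a i r) κ L B α β S x := by
  constructor <;> try rw [arr_setArr_of_isInput ha _ rfl]
  exacts [h.tests, h.dim, h.point, h.outcome, h.query, h.context, h.priorA, h.priorB, h.lipschitz,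
    h.kappa]

lemma HoldsInput.setNat (h : HoldsInput σ κ L B α β S x) {v : Reg} (ht : v ≠ .tests)
    (hd : v ≠ .dim) (k : ℕ) : HoldsInput (σ.setNat v k) κ L B α β S x := by
  constructor <;> simp only [Store.nat_setNat, Store.arr_setNat, ht.symm, hd.symm, if_false]
  exacts [h.tests, h.dim, h.point, h.outcome, h.query, h.context, h.priorA, h.priorB, h.lipschitz,
    h.kappa]

lemma ensures_setWidth (h : HoldsInput σ κ L B α β S x) (hL : 0 ≤ L) (hB : B ≤ 1) :
    setWidth.Ensures 30
      (fun τ => HoldsInput τ κ L B α β S x ∧ τ.arr .width 0 = kernelWidth d κ L B t) σ := by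
  refine (Cmd.Ensures.setR ⟨h.setArr rfl _ _, ?_⟩).mono (fun _ => id) (by simp)
  simp [h.kappa, h.dim, h.lipschitz, h.context, h.tests, kernelWidth_eq d hL hB, sq, mul_assoc]

/-- The memory during the scan of the tests: next to the input it holds the kernel width `Δ` and
the counters, `n` tests and `s` successes so far. -/
structure Scanning (σ : Memory) (κ L B α β : ℝ) (S : Data d t) (x : Cube d) (Δ : ℝ) (n s : ℕ) :
    Prop where
  input : HoldsInput σ κ L B α β S x
  width : σ.arr .width 0 = Δ
  near : σ.nat .near = n
  succs : σ.nat .succs = s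

lemma Scanning.setFlag (h : Scanning σ κ L B α β S x Δ n s) (r : ℝ) :
    Scanning (σ.setArr .flag 0 r) κ L B α β S x Δ n s :=
  ⟨h.input.setArr rfl _ _, by simpa using h.width, h.near, h.succs⟩

lemma Scanning.setIndex (h : Scanning σ κ L B α β S x Δ n s) {v : Reg} (hv : v = .i ∨ v = .j)
    (k : ℕ) : Scanning (σ.setNat v k) κ L B α β S x Δ n s := by
  rcases hv with rfl | rfl <;>
  exact ⟨h.input.setNat (by decide) (by decide) _, h.width, by simpa using h.near,
    by simpa using h.succs⟩

lemma Scanning.succNear (h : Scanning σ κ L B α β S x Δ n s) :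
    Scanning (σ.setNat .near (n + 1)) κ L B α β S x Δ (n + 1) s :=
  ⟨h.input.setNat (by decide) (by decide) _, h.width, by simp, by simpa using h.succs⟩

lemma Scanning.succSuccs (h : Scanning σ κ L B α β S x Δ n s) :
    Scanning (σ.setNat .succs (s + 1)) κ L B α β S x Δ n (s + 1) :=
  ⟨h.input.setNat (by decide) (by decide) _, h.width, by simpa using h.near, by simp⟩

/-- The body of the loop of `testNear`. -/
def testCoord : Cmd Reg Arr :=
  .seq
    (.ifLE (.sub (.get .query (.var .j)) pointCoord) (scalar .width)
      .skip (.setR .flag (.lit 0) (.lit 0)))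
    (.ifLE (.sub pointCoord (.get .query (.var .j))) (scalar .width)
      .skip (.setR .flag (.lit 0) (.lit 0)))

/-- The memory while the test point `i` is compared with the query point: the flag tells whether
the first `k` coordinates are within `Δ` of each other. -/
structure Comparing (σ : Memory) (κ L B α β : ℝ) (S : Data d t) (x : Cube d) (Δ : ℝ) (n s : ℕ)
    (i : Fin t) (k : ℕ) : Prop where
  scanning : Scanning σ κ L B α β S x Δ n s
  index : σ.nat .i = i
  flag : σ.arr .flag 0 =
    open Classical in if ∀ j : Fin d, (j : ℕ) < k → |x.vec j - (S i).1.vec j| ≤ Δ then 1 else 0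

lemma forall_lt_succ_iff {p : Fin d → Prop} {k : ℕ} (hk : k < d) :
    (∀ j : Fin d, (j : ℕ) < k + 1 → p j) ↔ (∀ j : Fin d, (j : ℕ) < k → p j) ∧ p ⟨k, hk⟩ := by
  refine ⟨fun h => ⟨fun j hj => h j (hj.trans k.lt_succ_self), h ⟨k, hk⟩ k.lt_succ_self⟩, ?_⟩
  rintro ⟨hlt, hp⟩ j hj
  rcases Nat.lt_succ_iff_lt_or_eq.1 hj with hjk | rfl
  · exact hlt j hjk
  · exact hp

lemma ensures_testCoord {i : Fin t} {k : ℕ} (h : Comparing σ κ L B α β S x Δ n s i k)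
    (hk : k < d) :
    testCoord.Ensures 39 (fun τ => Comparing τ κ L B α β S x Δ n s i (k + 1)) (σ.setNat .j k) := by
  have hscan := h.scanning.setIndex (Or.inr rfl) k
  have hquery : σ.arr .query k = x.vec ⟨k, hk⟩ := h.scanning.input.query ⟨k, hk⟩
  have hpoint : σ.arr .point (i * d + k) = (S i).1.vec ⟨k, hk⟩ :=
    h.scanning.input.point i ⟨k, hk⟩
  suffices hflag : Scanning (testCoord.run (σ.setNat .j k)).1 κ L B α β S x Δ n s ∧
      (testCoord.run (σ.setNat .j k)).1.nat .i = i ∧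
      (testCoord.run (σ.setNat .j k)).1.arr .flag 0 =
        (if x.vec ⟨k, hk⟩ - (S i).1.vec ⟨k, hk⟩ ≤ Δ ∧ (S i).1.vec ⟨k, hk⟩ - x.vec ⟨k, hk⟩ ≤ Δ
          then σ.arr .flag 0 else 0) ∧
      (testCoord.run (σ.setNat .j k)).2 ≤ 39 by
    obtain ⟨hscan', hindex, hflag, htime⟩ := hflag
    refine ⟨⟨hscan', hindex, ?_⟩, htime⟩
    rw [hflag, h.flag, ← ite_and]
    simp only [forall_lt_succ_iff hk, abs_sub_le_iff, and_comm]
  by_cases hle : x.vec ⟨k, hk⟩ - (S i).1.vec ⟨k, hk⟩ ≤ Δ <;>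
  by_cases hge : (S i).1.vec ⟨k, hk⟩ - x.vec ⟨k, hk⟩ ≤ Δ <;>
  simp [testCoord, h.index, h.scanning.input.dim, h.scanning.width, hquery, hpoint, hle, hge,
    hscan, hscan.setFlag, Scanning.setFlag]

open Classical in
lemma ensures_testNear {i : Fin t} (h : Scanning σ κ L B α β S x Δ n s) (hi : σ.nat .i = i) :
    testNear.Ensures (40 * d + 5) (fun τ => (Scanning τ κ L B α β S x Δ n s ∧ τ.nat .i = i) ∧
      τ.arr .flag 0 = if i ∈ neighbors Δ S x then 1 else 0) σ := by
  have hinit : (Cmd.setR .flag (.lit 0) (.lit 1)).Ensures 3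
      (fun τ => Comparing τ κ L B α β S x Δ n s i 0) σ :=
    .setR ⟨h.setFlag _, hi, by simp⟩
  have hloop : ∀ τ, Comparing τ κ L B α β S x Δ n s i 0 →
      (Cmd.loop .j (.var .dim) testCoord).Ensures (2 + d * 40)
        (fun τ => Comparing τ κ L B α β S x Δ n s i d) τ :=
    fun τ hτ => .loop (I := fun k ρ => Comparing ρ κ L B α β S x Δ n s i k)
      hτ.scanning.input.dim hτ fun k hk ρ hρ => ensures_testCoord hρ hk
  refine (hinit.seq hloop).mono (fun τ hτ => ⟨⟨hτ.scanning, hτ.index⟩, ?_⟩) (by omega)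
  rw [hτ.flag]
  simp [neighbors]

/-- The number of elements of `A` below `k`. -/
def countBelow (A : Finset (Fin t)) (k : ℕ) : ℕ :=
  Nat.count (· ∈ A.map Fin.valEmbedding) k

lemma countBelow_succ (A : Finset (Fin t)) (i : Fin t) :
    countBelow A (i + 1) = countBelow A i + if i ∈ A then 1 else 0 := by
  simp [countBelow, Nat.count_succ, ← Fin.ext_iff]

lemma countBelow_self (A : Finset (Fin t)) : countBelow A t = A.card := by
  rw [countBelow, Nat.count_eq_card_filter_range, Finset.filter_mem_eq_inter,
    Finset.inter_eq_right.2 fun k hk => ?_, Finset.card_map]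
  obtain ⟨i, -, rfl⟩ := Finset.mem_map.1 hk
  exact Finset.mem_range.2 i.isLt

/-- The body of the loop of `countNear`. -/
def countTest : Cmd Reg Arr :=
  .seq testNear <|
  .ifLE (.lit 1) (scalar .flag)
    (.seq (.setN .near (.add (.var .near) (.lit 1)))
      (.ifLE (.lit 1) (.get .outcome (.var .i))
        (.setN .succs (.add (.var .succs) (.lit 1)))
        .skip))
    .skip

open Classical in
lemma ensures_countTest {i : Fin t} (h : Scanning σ κ L B α β S x Δ n s) (hi : σ.nat .i = i) :
    countTest.Ensures (40 * d + 21) (fun τ => Scanning τ κ L B α β S x Δ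
      (n + if i ∈ neighbors Δ S x then 1 else 0)
      (s + if i ∈ (neighbors Δ S x).filter (fun i => (S i).2 = true) then 1 else 0)) σ := by
  refine ((ensures_testNear h hi).seq (b' := 16) ?_)
  rintro τ ⟨⟨hτ, hi⟩, hflag⟩
  have hout := hτ.input.outcome i
  rw [← hi] at hout
  have hlt : ¬ (1 : ℝ) ≤ 0 := zero_lt_one.not_ge
  by_cases hmem : i ∈ neighbors Δ S x <;>
  by_cases hsuc : (S i).2 = true <;>
  simp [Cmd.Ensures, hflag, hmem, hsuc, hout, hlt, hτ, hτ.near, hτ.succs, hτ.succNear,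
    hτ.succNear.succSuccs]

open Classical in
lemma ensures_countNear (h : HoldsInput σ κ L B α β S x) (hw : σ.arr .width 0 = Δ) :
    countNear.Ensures (t * (40 * d + 22) + 6)
      (fun τ => Scanning τ κ L B α β S x Δ (numNear Δ S x) (numSucc Δ S x)) σ := by
  let I : ℕ → Memory → Prop := fun k τ => Scanning τ κ L B α β S x Δ
    (countBelow (neighbors Δ S x) k)
    (countBelow ((neighbors Δ S x).filter fun i => (S i).2 = true) k)
  have hinit : I 0 ((σ.setNat .near 0).setNat .succs 0) :=
    ⟨(h.setNat (by decide) (by decide) _).setNat (by decide) (by decide) _, hw,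
      by simp [countBelow], by simp [countBelow]⟩
  have hloop : ∀ τ, I 0 τ →
      (Cmd.loop .i (.var .tests) countTest).Ensures (2 + t * (40 * d + 22)) (I t) τ := by
    refine fun τ hτ => .loop hτ.input.tests hτ fun k hk ρ hρ => ?_
    simp only [I, countBelow_succ _ (⟨k, hk⟩ : Fin t)]
    exact ensures_countTest (hρ.setIndex (Or.inl rfl) k) (by simp)
  have hreset : (Cmd.setN .near (.lit 0)).Ensures 2
      (fun τ => (Cmd.setN .succs (.lit 0)).Ensures 2 (I 0) τ) σ :=
    .setN (.setN hinit)
  refine (hreset.seq fun τ hτ => hτ.seq hloop).mono (fun τ hτ => ?_) (by omega)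
  simpa only [I, countBelow_self, numNear, numSucc] using hτ

end Scan

section Weights

variable {σ : Memory} {α β B : ℝ} {n s : ℕ}

lemma mixWeight_self_pos (hα : 0 < α) (hβ : 0 < β) (hsn : s ≤ n) :
    0 < mixWeight α β B n s s := by
  have hβ' : 0 < β + ((n : ℝ) - s) :=
    add_pos_of_pos_of_nonneg hβ (sub_nonneg.2 (Nat.cast_le.2 hsn))
  rw [mixWeight, Nat.choose_self, Nat.sub_self, pow_zero, mul_one, Nat.cast_one, one_mul]
  exact mul_pos (Real.Gamma_pos_of_pos (by positivity)) (Real.Gamma_pos_of_pos hβ')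

lemma mixWeight_eq_mul_succ (hα : 0 < α) (hβ : 0 < β) (hsn : s ≤ n) {i : ℕ} (hi : i < s) :
    mixWeight α β B n s i = mixWeight α β B n s (i + 1) *
      (B * ((i : ℝ) + 1) * (β + ((n - 1 - i : ℕ) : ℝ))) / (((s - i : ℕ) : ℝ) * (α + i)) := by
  have hsi : (0 : ℝ) < ((s - i : ℕ) : ℝ) := Nat.cast_pos.2 (Nat.sub_pos_of_lt hi)
  have hchoose : (s.choose (i + 1) : ℝ) * ((i : ℝ) + 1) = s.choose i * ((s - i : ℕ) : ℝ) := by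
    exact_mod_cast Nat.choose_succ_right_eq s i
  have hfail : ((n - 1 - i : ℕ) : ℝ) = (n : ℝ) - (i + 1 : ℕ) := by
    rw [← Nat.cast_sub (by omega), Nat.sub_sub, add_comm 1 i]
  have hΓα : Real.Gamma (α + (i + 1 : ℕ)) = (α + i) * Real.Gamma (α + i) := by
    rw [← Real.Gamma_add_one (by positivity), Nat.cast_succ, add_assoc]
  have hΓβ : Real.Gamma (β + ((n : ℝ) - i)) =
      (β + ((n - 1 - i : ℕ) : ℝ)) * Real.Gamma (β + ((n : ℝ) - (i + 1 : ℕ))) := by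
    rw [← hfail, ← Real.Gamma_add_one (by positivity), hfail]
    push_cast
    ring_nf
  have hB : B ^ (s - i) = B ^ (s - (i + 1)) * B := by
    rw [← pow_succ, ← Nat.sub_sub, Nat.sub_add_cancel (Nat.sub_pos_of_lt hi)]
  rw [eq_div_iff (by positivity), mixWeight, mixWeight, hΓα, hΓβ, hB]
  linear_combination (-(Real.Gamma (α + i) * (α + i) * (β + ((n - 1 - i : ℕ) : ℝ)) *
    Real.Gamma (β + ((n : ℝ) - (i + 1 : ℕ))) * (B ^ (s - (i + 1)) * B))) * hchoose

/-- The memory holds what the posterior depends on: the prior, the context parameter `B`, and the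
counts `n` and `s`. -/
structure HoldsCounts (σ : Memory) (α β B : ℝ) (n s : ℕ) : Prop where
  priorA : σ.arr .priorA 0 = α
  priorB : σ.arr .priorB 0 = β
  context : σ.arr .context 0 = B
  near : σ.nat .near = n
  succs : σ.nat .succs = s

lemma Scanning.holdsCounts {d t : ℕ} {κ L Δ : ℝ} {S : Data d t} {x : Cube d}
    (h : Scanning σ κ L B α β S x Δ n s) : HoldsCounts σ α β B n s :=
  ⟨h.input.priorA, h.input.priorB, h.input.context, h.near, h.succs⟩

lemma HoldsCounts.setIndex (h : HoldsCounts σ α β B n s) {v : Reg} (hv : v = .i ∨ v = .j)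
    (k : ℕ) : HoldsCounts (σ.setNat v k) α β B n s := by
  rcases hv with rfl | rfl <;>
  exact ⟨h.priorA, h.priorB, h.context, by simpa using h.near, by simpa using h.succs⟩

lemma HoldsCounts.setArr (h : HoldsCounts σ α β B n s) {a : Arr} (ha : a.isInput = false) (i : ℕ)
    (r : ℝ) : HoldsCounts (σ.setArr a i r) α β B n s := by
  constructor <;> try rw [arr_setArr_of_isInput ha _ rfl]
  exacts [h.priorA, h.priorB, h.context, h.near, h.succs]

/-- The memory holds the counts and, for the indices from `m` to `s`, the weights of the mixture,
scaled so that the weight of index `s` is `1`. -/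
structure HoldsWeights (σ : Memory) (α β B : ℝ) (n s m : ℕ) : Prop where
  counts : HoldsCounts σ α β B n s
  weight : ∀ i, m ≤ i → i ≤ s →
    σ.arr .weight i = mixWeight α β B n s i / mixWeight α β B n s s

lemma HoldsWeights.setIndex {m : ℕ} (h : HoldsWeights σ α β B n s m) {v : Reg}
    (hv : v = .i ∨ v = .j) (k : ℕ) : HoldsWeights (σ.setNat v k) α β B n s m :=
  ⟨h.counts.setIndex hv k, h.weight⟩

lemma HoldsWeights.setArr {m : ℕ} (h : HoldsWeights σ α β B n s m) {a : Arr}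
    (ha : a.isInput = false) (hw : .weight ≠ a) (i : ℕ) (r : ℝ) :
    HoldsWeights (σ.setArr a i r) α β B n s m :=
  ⟨h.counts.setArr ha i r, by simpa only [σ.arr_setArr_of_ne hw] using h.weight⟩

/-- The body of the loop of `setWeights`. -/
def setPrevWeight : Cmd Reg Arr :=
  .seq (.setN .i (.sub (.sub (.var .succs) (.lit 1)) (.var .j))) <|
  .setR .weight (.var .i)
    (.div
      (.mul (.get .weight (.add (.var .i) (.lit 1)))
        (.mul (.mul (scalar .context) (.ofNat (.add (.var .i) (.lit 1))))
          (.add (scalar .priorB) (.ofNat (.sub (.sub (.var .near) (.lit 1)) (.var .i))))))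
      (.mul (.ofNat (.sub (.var .succs) (.var .i)))
        (.add (scalar .priorA) (.ofNat (.var .i)))))

lemma ensures_setPrevWeight {k : ℕ} (h : HoldsWeights σ α β B n s (s - k)) (hα : 0 < α)
    (hβ : 0 < β) (hsn : s ≤ n) (hk : k < s) :
    setPrevWeight.Ensures 59 (fun τ => HoldsWeights τ α β B n s (s - (k + 1)))
      (σ.setNat .j k) := by
  have hrun : (setPrevWeight.run (σ.setNat .j k)).1 =
      ((σ.setNat .j k).setNat .i (s - 1 - k)).setArr .weight (s - 1 - k)
        (mixWeight α β B n s (s - 1 - k) / mixWeight α β B n s s) := by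
    rw [mixWeight_eq_mul_succ hα hβ hsn (show s - 1 - k < s by omega), div_right_comm,
      mul_div_right_comm]
    simp [setPrevWeight, h.counts.near, h.counts.succs, h.counts.context, h.counts.priorA,
      h.counts.priorB, h.weight (s - 1 - k + 1) (by omega) (by omega)]
  refine ⟨?_, by simp [setPrevWeight]⟩
  rw [hrun]
  refine ⟨((h.counts.setIndex (Or.inr rfl) _).setIndex (Or.inl rfl) _).setArr rfl _ _,
    fun i hki his => ?_⟩
  by_cases hik : i = s - 1 - k
  · simp [hik]
  · simpa [hik] using h.weight i (by omega) his

lemma ensures_setWeights (h : HoldsCounts σ α β B n s) (hα : 0 < α) (hβ : 0 < β) (hsn : s ≤ n) :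
    setWeights.Ensures (s * 60 + 5) (fun τ => HoldsWeights τ α β B n s 0) σ := by
  have hinit : (Cmd.setR .weight (.var .succs) (.lit 1)).Ensures 3
      (fun τ => HoldsWeights τ α β B n s s) σ := by
    refine .setR ⟨h.setArr rfl _ _, fun i hsi his => ?_⟩
    obtain rfl : i = s := le_antisymm his hsi
    simp [h.succs, (mixWeight_self_pos hα hβ hsn).ne']
  have hloop : ∀ τ, HoldsWeights τ α β B n s s →
      (Cmd.loop .j (.var .succs) setPrevWeight).Ensures (2 + s * 60)
        (fun τ => HoldsWeights τ α β B n s (s - s)) τ :=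
    fun τ hτ => .loop (I := fun k ρ => HoldsWeights ρ α β B n s (s - k)) hτ.counts.succs hτ
      fun k hk ρ hρ => ensures_setPrevWeight hρ hα hβ hsn hk
  refine (hinit.seq hloop).mono (fun τ hτ => ?_) (by omega)
  rwa [Nat.sub_self] at hτ

/-- The memory while the weights are added up: the total of the first `k` weights. -/
structure HoldsTotal (σ : Memory) (α β B : ℝ) (n s k : ℕ) : Prop where
  weights : HoldsWeights σ α β B n s 0
  total : σ.arr .total 0 =
    (∑ i ∈ Finset.range k, mixWeight α β B n s i) / mixWeight α β B n s s

/-- The body of the first loop of `writePosterior`. -/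
def addWeight : Cmd Reg Arr :=
  .setR .total (.lit 0) (.add (scalar .total) (.get .weight (.var .i)))

lemma ensures_addWeight {k : ℕ} (h : HoldsTotal σ α β B n s k) (hk : k ≤ s) :
    addWeight.Ensures 7 (fun τ => HoldsTotal τ α β B n s (k + 1)) (σ.setNat .i k) := by
  refine .setR ⟨(h.weights.setIndex (Or.inl rfl) _).setArr rfl (by decide) _ _, ?_⟩
  simp [h.total, h.weights.weight k k.zero_le hk, Finset.sum_range_succ, add_div]

/-- The memory while the mixture is written out: its first `k` components. -/
structure HoldsComponents (σ : Memory) (α β B : ℝ) (n s k : ℕ) : Prop where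
  total : HoldsTotal σ α β B n s (s + 1)
  coef : ∀ i < k, σ.arr .coef i = mixCoef α β B n s i
  shapeA : ∀ i < k, σ.arr .shapeA i = α + i
  shapeB : ∀ i < k, σ.arr .shapeB i = β + ((n - i : ℕ) : ℝ)

/-- The body of the second loop of `writePosterior`. -/
def writeComponent : Cmd Reg Arr :=
  .seq (.setR .coef (.var .i) (.div (.get .weight (.var .i)) (scalar .total))) <|
  .seq (.setR .shapeA (.var .i) (.add (scalar .priorA) (.ofNat (.var .i)))) <|
  .setR .shapeB (.var .i)
    (.add (scalar .priorB) (.ofNat (.sub (.var .near) (.var .i))))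

lemma ensures_writeComponent {k : ℕ} (h : HoldsComponents σ α β B n s k) (hα : 0 < α)
    (hβ : 0 < β) (hsn : s ≤ n) (hk : k ≤ s) :
    writeComponent.Ensures 38 (fun τ => HoldsComponents τ α β B n s (k + 1))
      (σ.setNat .i k) := by
  have hweights := h.total.weights
  have hcoef : mixWeight α β B n s k / mixWeight α β B n s s /
      ((∑ i ∈ Finset.range (s + 1), mixWeight α β B n s i) / mixWeight α β B n s s) =
      mixCoef α β B n s k :=
    div_div_div_cancel_right₀ (mixWeight_self_pos hα hβ hsn).ne' _ _
  have hrun : (writeComponent.run (σ.setNat .i k)).1 =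
      (((σ.setNat .i k).setArr .coef k (mixCoef α β B n s k)).setArr .shapeA k
        (α + k)).setArr .shapeB k (β + ((n - k : ℕ) : ℝ)) := by
    simp [writeComponent, hweights.counts.near, hweights.counts.priorA, hweights.counts.priorB,
      h.total.total, hweights.weight k k.zero_le hk, hcoef]
  refine ⟨?_, by simp [writeComponent]⟩
  rw [hrun]
  refine ⟨⟨(((hweights.setIndex (Or.inl rfl) _).setArr rfl (by decide) _ _).setArr rfl
    (by decide) _ _).setArr rfl (by decide) _ _, by simpa using h.total.total⟩, ?_, ?_, ?_⟩
  all_goals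
    intro i hi
    rcases Nat.lt_succ_iff_lt_or_eq.1 hi with hik | rfl
    · simp [hik, hik.ne, h.coef, h.shapeA, h.shapeB]
    · simp

lemma ensures_writePosterior (h : HoldsWeights σ α β B n s 0) (hα : 0 < α) (hβ : 0 < β)
    (hsn : s ≤ n) :
    writePosterior.Ensures ((s + 1) * 47 + 11) (fun τ => HoldsMixture τ α β B n s) σ := by
  have hlen : ∀ τ : Memory, HoldsWeights τ α β B n s 0 →
      NExp.eval τ (.add (.var .succs) (.lit 1)) = s + 1 := fun τ hτ => by
    simp [hτ.counts.succs]
  have hinit : (Cmd.setR .total (.lit 0) (.lit 0)).Ensures 3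
      (fun τ => HoldsTotal τ α β B n s 0) σ :=
    .setR ⟨h.setArr rfl (by decide) _ _, by simp⟩
  have hadd : ∀ τ, HoldsTotal τ α β B n s 0 →
      (Cmd.loop .i (.add (.var .succs) (.lit 1)) addWeight).Ensures (4 + (s + 1) * 8)
        (fun τ => HoldsTotal τ α β B n s (s + 1)) τ :=
    fun τ hτ => .loop (I := fun k ρ => HoldsTotal ρ α β B n s k) (hlen τ hτ.weights) hτ
      fun k hk ρ hρ => ensures_addWeight hρ (Nat.lt_succ_iff.1 hk)
  have hwrite : ∀ τ, HoldsTotal τ α β B n s (s + 1) →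
      (Cmd.loop .i (.add (.var .succs) (.lit 1)) writeComponent).Ensures (4 + (s + 1) * 39)
        (fun τ => HoldsComponents τ α β B n s (s + 1)) τ :=
    fun τ hτ => .loop (I := fun k ρ => HoldsComponents ρ α β B n s k) (hlen τ hτ.weights)
      ⟨hτ, by simp, by simp, by simp⟩
      fun k hk ρ hρ => ensures_writeComponent hρ hα hβ hsn (Nat.lt_succ_iff.1 hk)
  refine (hinit.seq fun τ hτ => (hadd τ hτ).seq hwrite).mono (fun τ hτ => ?_) (by omega)
  refine ⟨hτ.total.weights.counts.succs, fun i hi => hτ.coef i (Nat.lt_succ_iff.2 hi),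
    fun i hi => hτ.shapeA i (Nat.lt_succ_iff.2 hi), fun i hi => ?_⟩
  rw [hτ.shapeB i (Nat.lt_succ_iff.2 hi), Nat.cast_sub (hi.trans hsn)]

end Weights

lemma numNear_le {d t : ℕ} (Δ : ℝ) (S : Data d t) (x : Cube d) : numNear Δ S x ≤ t :=
  (Finset.card_le_univ _).trans_eq (Fintype.card_fin t)

lemma numSucc_le_numNear {d t : ℕ} (Δ : ℝ) (S : Data d t) (x : Cube d) :
    numSucc Δ S x ≤ numNear Δ S x :=
  Nat.le.intro (numSucc_add_numFail Δ S x)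

theorem ensures_inference {d t : ℕ} {σ : Memory} {κ L B α β : ℝ} {S : Data d t} {x : Cube d}
    (h : HoldsInput σ κ L B α β S x) (hL : 0 ≤ L) (hB : B ≤ 1) (hα : 0 < α) (hβ : 0 < β)
    (ht : 0 < t) :
    inference.Ensures ((40 * d + 228) * t) (fun τ => HoldsMixture τ α β B
      (numNear (kernelWidth d κ L B t) S x) (numSucc (kernelWidth d κ L B t) S x)) σ := by
  have hsn := numSucc_le_numNear (kernelWidth d κ L B t) S x
  have hnt := numNear_le (kernelWidth d κ L B t) S x
  refine ((ensures_setWidth h hL hB).seq fun τ hτ => (ensures_countNear hτ.1 hτ.2).seq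
    fun ρ hρ => (ensures_setWeights hρ.holdsCounts hα hβ hsn).seq
    fun ν hν => ensures_writePosterior hν hα hβ hsn).mono (fun _ => id) ?_
  linarith

end SmoothBeta

theorem theorem3 (d : ℕ) (N : Seminorm ℝ (Fin d → ℝ)) :
    (∀ κ : ℝ, 0 < κ → ∃ C : ℝ, 0 < C ∧
      ∀ L B : ℝ, 0 < L → 0 ≤ B → B < 1 →
      ∀ π : SmoothBeta.Cube d → ℝ, (∀ x, 0 < π x ∧ π x ≤ 1) →
      (∀ x y, |π x - π y| ≤ L * N (x.vec - y.vec)) →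
      ∀ t : ℕ, 1 ≤ L ^ 2 * ((1 - B) * t) →
        SmoothBeta.supMeanSquareError π B (SmoothBeta.kernelWidth d κ L B t) t
          ≤ ENNReal.ofReal (C * (L ^ (2 * (d : ℝ) / ((d : ℝ) + 2)) *
              ((1 - B) * t) ^ (-(2 : ℝ) / ((d : ℝ) + 2))))) ∧
    (∃ K : ℕ, ∀ κ L B α β : ℝ, 0 < κ → 0 < L → 0 ≤ B → B < 1 → 0 < α → 0 < β →
      ∀ t : ℕ, 0 < t → ∀ (S : SmoothBeta.Data d t) (x : SmoothBeta.Cube d) (σ : SmoothBeta.Memory),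
        SmoothBeta.HoldsInput σ κ L B α β S x →
        SmoothBeta.HoldsMixture (SmoothBeta.inference.run σ).1 α β B
            (SmoothBeta.numNear (SmoothBeta.kernelWidth d κ L B t) S x)
            (SmoothBeta.numSucc (SmoothBeta.kernelWidth d κ L B t) S x) ∧
          (SmoothBeta.inference.run σ).2 ≤ K * t) := by
  refine ⟨fun κ hκ => ?_, 40 * d + 228, fun κ L B α β _ hL _ hB1 hα hβ t ht S x σ h =>
    SmoothBeta.ensures_inference h hL.le hB1.le hα hβ ht⟩
  obtain ⟨C, hC, hrate⟩ := SmoothBeta.supMeanSquareError_kernelWidth_le N hκ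
  exact ⟨C, hC, fun L B hL hB hB1 π hπ =>
    hrate L B hL hB hB1 π fun x => ⟨(hπ x).1.le, (hπ x).2⟩⟩
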